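/- Let $0<\omega<m$ and consider on $\mathbb R^2$ the focusing cubic Dirac equation $$(\mathcal D+m\sigma_3-\omega)\psi-|\psi|^2\psi=0,\qquad \mathcal D=-i(\sigma_1\partial_1+\sigma_2\partial_2),\quad \psi:\mathbb R^2\to\mathbb C^2,\tag{1}$$ where $\sigma_1=\begin{pmatrix}0&1\\1&0\end{pmatrix}$, $\sigma_2=\begin{pmatrix}0&-i\\i&0\end{pmatrix}$, $\sigma_3=\begin{pmatrix}1&0\\0&-1\end{pmatrix}$ are the Pauli matrices. For $\lambda>0$ consider the $C^1$ solution $(u_\lambda,v_\lambda)$ on $[0,\infty)$ of $$u'+\frac ur=(u^2+v^2)v-(m-\omega)v,\qquad v'=-(u^2+v^2)u-(m+\omega)u\qquad(r>0),$$ with $u(0)=0$, $v(0)=\lambda$. Let $H(u,v)=\tfrac14(u^2+v^2)^2+\tfrac m2(u^2-v^2)+\tfrac\omega2(u^2+v^2)$ and let $A_0$ be the set of all $\lambda>0$ such that $\lim_{r\to\infty}H(u_\lambda(r),v_\lambda(r))<0$ and $v_\lambda$ does not change sign on $(0,\infty)$. Then $A_0$ is nonempty and bounded, and for $\lambda=\sup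 A_0>0$ the solution $(u,v)=(u_\lambda,v_\lambda)$ satisfies $v(r)>0$ for all $r\ge0$ and $(u(r),v(r))\to(0,0)$ as $r\to\infty$. Moreover the function given in polar coordinates by $$\psi(r,\theta)=\begin{pmatrix}v(r)\\ i\,u(r)e^{i\theta}\end{pmatrix}$$ is a nontrivial $C^\infty$ solution of (1) on $\mathbb R^2$ that decays exponentially at infinity: there is a constant $C>0$ with $$|\psi(x)|\le C\,e^{-\frac{m-\omega}{2}|x|}\qquad\text{for all }x\in\mathbb R^2 .$$ -/

import Mathlib

open Filter Topology

noncomputable section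

namespace CubicDirac

/-- The plane `ℝ²` with its Euclidean norm. -/
abbrev Plane : Type := EuclideanSpace ℝ (Fin 2)

/-- The spinor space `ℂ²` with its Hermitian norm. -/
abbrev Spinor : Type := EuclideanSpace ℂ (Fin 2)

/-- The first Pauli matrix. -/
def pauli1 : Matrix (Fin 2) (Fin 2) ℂ := !![0, 1; 1, 0]

/-- The second Pauli matrix. -/
def pauli2 : Matrix (Fin 2) (Fin 2) ℂ := !![0, -Complex.I; Complex.I, 0]

/-- The third Pauli matrix. -/
def pauli3 : Matrix (Fin 2) (Fin 2) ℂ := !![1, 0; 0, -1]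

/-- A `2 × 2` complex matrix acting on a spinor. -/
def act (A : Matrix (Fin 2) (Fin 2) ℂ) (z : Spinor) : Spinor :=
  WithLp.toLp 2 (A.mulVec z.ofLp)

/-- The partial derivative `∂ⱼ ψ` at `x`. -/
def partialDeriv (j : Fin 2) (ψ : Plane → Spinor) (x : Plane) : Spinor :=
  fderiv ℝ ψ x (EuclideanSpace.single j (1 : ℝ))

/-- The massless Dirac operator `𝒟 = -i (σ₁ ∂₁ + σ₂ ∂₂)`. -/
def diracOp (ψ : Plane → Spinor) (x : Plane) : Spinor :=
  (-Complex.I) • (act pauli1 (partialDeriv 0 ψ x) + act pauli2 (partialDeriv 1 ψ x))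

/-- `ψ` is a smooth solution on all of `ℝ²` of `(𝒟 + m σ₃ - ω) ψ - |ψ|² ψ = 0`. -/
def IsSmoothSolution (m ω : ℝ) (ψ : Plane → Spinor) : Prop :=
  ContDiff ℝ (⊤ : ℕ∞) ψ ∧
    ∀ x : Plane,
      diracOp ψ x + m • act pauli3 (ψ x) - ω • ψ x - (‖ψ x‖ ^ 2) • ψ x = 0

/-- The point of the plane with polar coordinates `(r, θ)`. -/
def polarPoint (r θ : ℝ) : Plane := !₂[r * Real.cos θ, r * Real.sin θ]

/-- `ψ(r, θ) = (v(r), i u(r) e^{iθ})` in polar coordinates. -/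
def HasRadialForm (ψ : Plane → Spinor) (u v : ℝ → ℝ) : Prop :=
  ∀ r θ : ℝ, 0 ≤ r →
    ψ (polarPoint r θ) =
      !₂[(v r : ℂ), Complex.I * (u r : ℂ) * Complex.exp (Complex.I * (θ : ℂ))]

/-- `(u, v)` is a `C¹` solution on `[0, ∞)` of the singular radial system
`u' + u / r = (u² + v²) v - (m - ω) v`, `v' = -(u² + v²) u - (m + ω) u` (for `r > 0`),
with `u(0) = 0` and `v(0) = a`. Values at negative arguments play no role. -/
structure IsRadialSolution (m ω a : ℝ) (u v : ℝ → ℝ) : Prop where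
  contDiffOn_u : ContDiffOn ℝ 1 u (Set.Ici 0)
  contDiffOn_v : ContDiffOn ℝ 1 v (Set.Ici 0)
  u_zero : u 0 = 0
  v_zero : v 0 = a
  eq_u : ∀ r : ℝ, 0 < r →
    deriv u r + u r / r = (u r ^ 2 + v r ^ 2) * v r - (m - ω) * v r
  eq_v : ∀ r : ℝ, 0 < r →
    deriv v r = -(u r ^ 2 + v r ^ 2) * u r - (m + ω) * u r

/-- The Hamiltonian `H(u, v)`. -/
def energy (m ω u v : ℝ) : ℝ :=
  (u ^ 2 + v ^ 2) ^ 2 / 4 + m / 2 * (u ^ 2 - v ^ 2) + ω / 2 * (u ^ 2 + v ^ 2)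

/-- `v` does not change sign on `(0, ∞)`. -/
def NoSignChange (v : ℝ → ℝ) : Prop :=
  ∀ r s : ℝ, 0 < r → 0 < s → 0 ≤ v r * v s

/-- The set `A₀` of shooting data `a > 0` for which the solution has negative limiting
energy as `r → ∞`, while its second component does not change sign on `(0, ∞)`. -/
def shootingSet (m ω : ℝ) : Set ℝ :=
  {a : ℝ | 0 < a ∧ ∃ u v : ℝ → ℝ, IsRadialSolution m ω a u v ∧ NoSignChange v ∧
    ∃ L : ℝ, L < 0 ∧ Tendsto (fun r : ℝ => energy m ω (u r) (v r)) atTop (𝓝 L)}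

end CubicDirac

end

/-! Put `α = m - ω` and `β = m + ω`. The radial system is the Hamiltonian system `u' = ∂H/∂v`, `v' =
-∂H/∂u` with the friction term `-u / r` added to the first equation, so `H` decreases along
solutions. This gives global bounds, and it makes negative energy a trap: `H` is nonnegative on the
line `v = 0`, so once `H < 0` the sign of `v` is frozen. Hence membership in the shooting set
amounts to `v > 0` together with `H < 0` at one finite radius, which is an open condition on the
datum. The set contains the equilibrium datum `√α`.

The hard point is boundedness (`RadialFlow.sq_le_of_v_pos`). Scaling turns a large datum `a` into
datum `1` with small masses `α / a²`, `β / a²`, close on bounded intervals to the explicit massless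
solution `(2r, 4) / (4 + r²)`. That solution never changes sign, so a finer argument is needed over
long distances. The Pohozaev functional `N = r² H - r u v / 2` satisfies `N' = (r / 2) (β u² - α
v²)`. If `v` stayed positive, then up to a radius `R₁` of order `β^(-1/2)` one would have `2 v ≤ u`
and `r² (u² + v²)` bounded above and below, so `N' ≥ c β / r`. Thus `N` would gain `c β log (R₁ /
8)` on `[8, R₁]`, whereas `N(8) ≥ -48 α` and `N(R₁)` is only `O(β)`. This fails for small `β`.

At the supremum, approximation by members gives `v ≥ 0`, hence `v > 0`, and openness excludes
negative energy. Then `u > 0`, so `v` decreases; `v`, `H` and therefore `u` converge, necessarily to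
a rest point of the limiting system, and `H ≥ 0` leaves only the origin. Decay follows from a
differential inequality for `u v`.

In the variable `s = r²` one has `u = r U(s)`, `v = V(s)` with `U`, `V` smooth up to `s = 0`, so the
spinor `(V(|x|²), i (x₁ + i x₂) U(|x|²))` is smooth on the whole plane. -/

namespace CubicDirac

/-! ### Monotonicity and continuous induction -/

/-- A function with nonpositive derivative on the open interval does not increase. -/
theorem le_of_hasDerivAt_nonpos {f f' : ℝ → ℝ} {a b : ℝ} (hab : a ≤ b)
    (hc : ContinuousOn f (Set.Icc a b)) (hd : ∀ r ∈ Set.Ioo a b, HasDerivAt f (f' r) r)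
    (hn : ∀ r ∈ Set.Ioo a b, f' r ≤ 0) : f b ≤ f a := by
  refine antitoneOn_of_deriv_nonpos (convex_Icc a b) hc ?_ ?_ (Set.left_mem_Icc.2 hab)
    (Set.right_mem_Icc.2 hab) hab
  · rw [interior_Icc]
    exact fun r hr => (hd r hr).differentiableAt.differentiableWithinAt
  · rw [interior_Icc]
    exact fun r hr => (hd r hr).deriv ▸ hn r hr

/-- A function with nonnegative derivative on the open interval does not decrease. -/
theorem le_of_hasDerivAt_nonneg {f f' : ℝ → ℝ} {a b : ℝ} (hab : a ≤ b)
    (hc : ContinuousOn f (Set.Icc a b)) (hd : ∀ r ∈ Set.Ioo a b, HasDerivAt f (f' r) r)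
    (hn : ∀ r ∈ Set.Ioo a b, 0 ≤ f' r) : f a ≤ f b := by
  have := le_of_hasDerivAt_nonpos (f := fun r => -f r) (f' := fun r => -f' r) hab hc.neg
    (fun r hr => (hd r hr).neg) (fun r hr => neg_nonpos.2 (hn r hr))
  linarith

/-- Continuous induction: positivity on an initial segment propagates. -/
theorem pos_on_Icc_of_propagates {f : ℝ → ℝ} {a b : ℝ} (hc : ContinuousOn f (Set.Icc a b))
    (h : ∀ r ∈ Set.Icc a b, (∀ t ∈ Set.Ico a r, 0 < f t) → 0 < f r) :
    ∀ r ∈ Set.Icc a b, 0 < f r := by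
  by_contra! hcon
  obtain ⟨r, hr, hfr⟩ := hcon
  have hcl : IsClosed (Set.Icc a b ∩ f ⁻¹' Set.Iic 0) :=
    hc.preimage_isClosed_of_isClosed isClosed_Icc isClosed_Iic
  have hcp : IsCompact (Set.Icc a b ∩ f ⁻¹' Set.Iic 0) :=
    isCompact_Icc.of_isClosed_subset hcl Set.inter_subset_left
  obtain ⟨x, hx, hmin⟩ := hcp.exists_isLeast ⟨r, hr, hfr⟩
  refine absurd (h x hx.1 fun t ht => ?_) (not_lt.2 hx.2)
  by_contra! hft
  exact absurd (hmin ⟨⟨ht.1, ht.2.le.trans hx.1.2⟩, hft⟩) (not_le.2 ht.2)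

/-! ### The radial system: energy, a priori bounds, continuous dependence -/

/-- A continuous solution on `[0, ∞)` of `u' + u / r = (u² + v² - α) v`, `v' = -(u² + v² + β) u`
with `u(0) = 0`, `v(0) = a`. -/
structure RadialFlow (α β a : ℝ) (u v : ℝ → ℝ) : Prop where
  cont_u : ContinuousOn u (Set.Ici 0)
  cont_v : ContinuousOn v (Set.Ici 0)
  u_zero : u 0 = 0
  v_zero : v 0 = a
  hasDeriv_u : ∀ r, 0 < r → HasDerivAt u ((u r ^ 2 + v r ^ 2 - α) * v r - u r / r) r
  hasDeriv_v : ∀ r, 0 < r → HasDerivAt v (-(u r ^ 2 + v r ^ 2 + β) * u r) r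

theorem IsRadialSolution.radialFlow {m ω a : ℝ} {u v : ℝ → ℝ} (h : IsRadialSolution m ω a u v) :
    RadialFlow (m - ω) (m + ω) a u v where
  cont_u := h.contDiffOn_u.continuousOn
  cont_v := h.contDiffOn_v.continuousOn
  u_zero := h.u_zero
  v_zero := h.v_zero
  hasDeriv_u r hr := by
    have hd : DifferentiableAt ℝ u r :=
      (h.contDiffOn_u.differentiableOn one_ne_zero).differentiableAt (Ici_mem_nhds hr)
    have := h.eq_u r hr
    exact hd.hasDerivAt.congr_deriv (by linarith)
  hasDeriv_v r hr := by
    have hd : DifferentiableAt ℝ v r :=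
      (h.contDiffOn_v.differentiableOn one_ne_zero).differentiableAt (Ici_mem_nhds hr)
    have := h.eq_v r hr
    exact hd.hasDerivAt.congr_deriv (by linarith)

/-- The Hamiltonian in terms of `α = m - ω` and `β = m + ω`. -/
noncomputable def hamiltonian (α β u v : ℝ) : ℝ := (u ^ 2 + v ^ 2) ^ 2 / 4 + (β * u ^ 2 - α * v ^ 2) / 2

theorem energy_eq_hamiltonian (m ω u v : ℝ) :
    energy m ω u v = hamiltonian (m - ω) (m + ω) u v := by
  unfold energy hamiltonian; ring

/-- The Hamiltonian part of the field is tangent to the level sets of `H`; only the friction `-u /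
r`, paired with `∂H/∂u = (u² + v² + β) u`, contributes. -/
theorem hasDerivAt_hamiltonian {α β r : ℝ} {u v : ℝ → ℝ} (hr : 0 < r)
    (hu : HasDerivAt u ((u r ^ 2 + v r ^ 2 - α) * v r - u r / r) r)
    (hv : HasDerivAt v (-(u r ^ 2 + v r ^ 2 + β) * u r) r) :
    HasDerivAt (fun r => hamiltonian α β (u r) (v r))
      (-(u r ^ 2 / r * (u r ^ 2 + v r ^ 2 + β))) r := by
  unfold hamiltonian
  refine (((((hu.pow 2).add (hv.pow 2)).pow 2).div_const 4).add
    ((((hu.pow 2).const_mul β).sub ((hv.pow 2).const_mul α)).div_const 2)).congr_deriv ?_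
  simp only [Pi.add_apply, Pi.pow_apply]
  push_cast
  field_simp
  ring

/-- With `n = x² + y²` one has `4 H(x, y) ≥ n (n - 2α)`, which exceeds `4 H(0, a) = a² (a² - 2α)`
once `n > a² + 2α`. -/
theorem normSq_le_of_hamiltonian_le {α β a x y : ℝ} (hα : 0 ≤ α) (hβ : 0 ≤ β)
    (h1 : hamiltonian α β x y ≤ hamiltonian α β 0 a) : x ^ 2 + y ^ 2 ≤ a ^ 2 + 2 * α := by
  unfold hamiltonian at h1
  by_contra! hc
  have h2 : 0 ≤ x ^ 2 := sq_nonneg _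
  have h3 : 0 ≤ y ^ 2 := sq_nonneg _
  have h4 : 0 ≤ a ^ 2 := sq_nonneg _
  have h5 : 0 ≤ β * x ^ 2 := by positivity
  have h6 : 0 ≤ α * x ^ 2 := by positivity
  nlinarith

namespace RadialFlow

variable {α β a : ℝ} {u v : ℝ → ℝ}

theorem continuousOn_hamiltonian (h : RadialFlow α β a u v) :
    ContinuousOn (fun r => hamiltonian α β (u r) (v r)) (Set.Ici 0) := by
  have := h.cont_u
  have := h.cont_v
  unfold hamiltonian
  fun_prop

theorem hasDerivAt_hamiltonian (h : RadialFlow α β a u v) {r : ℝ} (hr : 0 < r) :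
    HasDerivAt (fun r => hamiltonian α β (u r) (v r))
      (-(u r ^ 2 / r * (u r ^ 2 + v r ^ 2 + β))) r :=
  CubicDirac.hasDerivAt_hamiltonian hr (h.hasDeriv_u r hr) (h.hasDeriv_v r hr)

theorem hamiltonian_antitone (hβ : 0 ≤ β) (h : RadialFlow α β a u v) {r s : ℝ} (hr : 0 ≤ r)
    (hrs : r ≤ s) : hamiltonian α β (u s) (v s) ≤ hamiltonian α β (u r) (v r) := by
  refine le_of_hasDerivAt_nonpos hrs
    (h.continuousOn_hamiltonian.mono fun t ht => hr.trans ht.1)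
    (fun t ht => h.hasDerivAt_hamiltonian (hr.trans_lt ht.1)) fun t ht => ?_
  have : 0 < t := hr.trans_lt ht.1
  rw [neg_nonpos]
  positivity

theorem normSq_le (hα : 0 ≤ α) (hβ : 0 ≤ β) (h : RadialFlow α β a u v) {r : ℝ} (hr : 0 ≤ r) :
    u r ^ 2 + v r ^ 2 ≤ a ^ 2 + 2 * α := by
  have h1 := h.hamiltonian_antitone hβ le_rfl hr
  rw [h.u_zero, h.v_zero] at h1
  exact normSq_le_of_hamiltonian_le hα hβ h1

theorem hasDerivAt_normSq (h : RadialFlow α β a u v) {r : ℝ} (hr : 0 < r) :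
    HasDerivAt (fun r => u r ^ 2 + v r ^ 2) (-2 * u r ^ 2 / r - 2 * (α + β) * (u r * v r)) r := by
  refine (((h.hasDeriv_u r hr).pow 2).add ((h.hasDeriv_v r hr).pow 2)).congr_deriv ?_
  push_cast
  field_simp
  ring

/-- The weight `r²` absorbs the friction and the exponential completes the coupling `-2 (α + β) u v`
to a square. This gives a lower bound on `u² + v²` going outward. -/
theorem weighted_normSq_mono (hα : 0 ≤ α) (hβ : 0 ≤ β) (h : RadialFlow α β a u v) {r s : ℝ}
    (hr : 0 ≤ r) (hrs : r ≤ s) :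
    r ^ 2 * (u r ^ 2 + v r ^ 2) * Real.exp ((α + β) * r) ≤
      s ^ 2 * (u s ^ 2 + v s ^ 2) * Real.exp ((α + β) * s) := by
  have hcu := h.cont_u.mono (fun t (ht : t ∈ Set.Icc r s) => hr.trans ht.1)
  have hcv := h.cont_v.mono (fun t (ht : t ∈ Set.Icc r s) => hr.trans ht.1)
  refine le_of_hasDerivAt_nonneg
    (f := fun t => t ^ 2 * (u t ^ 2 + v t ^ 2) * Real.exp ((α + β) * t))
    (f' := fun t => (2 * t * v t ^ 2 + (α + β) * t ^ 2 * (u t - v t) ^ 2) *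
      Real.exp ((α + β) * t)) hrs (by fun_prop) (fun t ht => ?_) fun t ht => ?_
  · have ht0 : 0 < t := hr.trans_lt ht.1
    refine (((hasDerivAt_pow 2 t).mul (h.hasDerivAt_normSq ht0)).mul
      (((hasDerivAt_id t).const_mul (α + β)).exp)).congr_deriv ?_
    simp only [Pi.mul_apply, id]
    push_cast
    field_simp
    ring
  · have ht0 : 0 < t := hr.trans_lt ht.1
    positivity

theorem normSq_pos (hα : 0 ≤ α) (hβ : 0 ≤ β) (ha : 0 < a) (h : RadialFlow α β a u v) {r : ℝ}
    (hr : 0 ≤ r) : 0 < u r ^ 2 + v r ^ 2 := by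
  have hev : ∀ᶠ t in 𝓝[≥] (0 : ℝ), 0 < v t := by
    have := (h.cont_v 0 Set.self_mem_Ici).eventually (lt_mem_nhds (a := 0) (by rwa [h.v_zero]))
    exact this
  rcases hr.eq_or_lt with rfl | hr
  · have := h.v_zero
    have := h.u_zero
    simp_all
  obtain ⟨t, htv, ht0, htr⟩ := ((hev.filter_mono (nhdsWithin_mono _ Set.Ioi_subset_Ici_self)).and
    (Ioo_mem_nhdsGT hr)).exists
  have h1 := h.weighted_normSq_mono hα hβ ht0.le htr.le
  have h2 : 0 < t ^ 2 * (u t ^ 2 + v t ^ 2) * Real.exp ((α + β) * t) := by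
    have : 0 < t := ht0
    positivity
  by_contra! hc
  have h3 : u r ^ 2 + v r ^ 2 = 0 := le_antisymm hc (by positivity)
  rw [h3] at h1
  simp at h1
  linarith

/-- If `v` is nonnegative, it is positive. -/
theorem v_pos_of_nonneg (hα : 0 ≤ α) (hβ : 0 < β) (ha : 0 < a) (h : RadialFlow α β a u v)
    (hv : ∀ r, 0 < r → 0 ≤ v r) {r : ℝ} (hr : 0 ≤ r) : 0 < v r := by
  rcases hr.eq_or_lt with rfl | hr
  · rwa [h.v_zero]
  refine (hv r hr).lt_of_ne fun h0 => ?_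
  -- A zero of `v` would be an interior minimum, so `v' = 0`; this forces `u = 0` too, against
  -- `normSq_pos`.
  have hmin : IsLocalMin v r := by
    filter_upwards [lt_mem_nhds hr] with t ht
    rw [← h0]
    exact hv t ht
  have h1 := hmin.hasDerivAt_eq_zero (h.hasDeriv_v r hr)
  have h2 := h.normSq_pos hα hβ.le ha hr.le
  have h3 : u r = 0 := by
    rcases mul_eq_zero.1 h1 with h4 | h4
    · linarith
    · exact h4
  rw [h3, ← h0] at h2
  simp at h2

/-- Continuous dependence on the parameters. -/
theorem dist_sq_le {α₁ β₁ a₁ α₂ β₂ a₂ B R : ℝ} {u₁ v₁ u₂ v₂ : ℝ → ℝ}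
    (h₁ : RadialFlow α₁ β₁ a₁ u₁ v₁) (h₂ : RadialFlow α₂ β₂ a₂ u₂ v₂)
    (hα₁ : 0 ≤ α₁) (hβ₁ : 0 ≤ β₁)
    (hB₁ : ∀ r ∈ Set.Icc 0 R, u₁ r ^ 2 + v₁ r ^ 2 ≤ B)
    (hB₂ : ∀ r ∈ Set.Icc 0 R, u₂ r ^ 2 + v₂ r ^ 2 ≤ B) {r : ℝ} (hr : r ∈ Set.Icc 0 R) :
    (u₁ r - u₂ r) ^ 2 + (v₁ r - v₂ r) ^ 2 ≤
      ((a₁ - a₂) ^ 2 + B * ((α₁ - α₂) ^ 2 + (β₁ - β₂) ^ 2) * r) *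
        Real.exp ((4 * B + α₁ + β₁ + 1) * r) := by
  -- Gronwall rate: `4 * B` controls the cubic terms, `α₁ + β₁` the linear coupling, and `1` the
  -- cross terms from differing parameters, whose remainder is `η`. The singular term has a
  -- favourable sign and is dropped.
  set K := 4 * B + α₁ + β₁ + 1 with hK
  set η := B * ((α₁ - α₂) ^ 2 + (β₁ - β₂) ^ 2) with hη
  have hB0 : 0 ≤ B := le_trans (by positivity) (hB₁ r hr)
  have hη0 : 0 ≤ η := by positivity
  have hcu₁ := h₁.cont_u.mono (fun t (ht : t ∈ Set.Icc 0 r) => ht.1)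
  have hcv₁ := h₁.cont_v.mono (fun t (ht : t ∈ Set.Icc 0 r) => ht.1)
  have hcu₂ := h₂.cont_u.mono (fun t (ht : t ∈ Set.Icc 0 r) => ht.1)
  have hcv₂ := h₂.cont_v.mono (fun t (ht : t ∈ Set.Icc 0 r) => ht.1)
  have key := le_of_hasDerivAt_nonpos
    (f := fun t => ((u₁ t - u₂ t) ^ 2 + (v₁ t - v₂ t) ^ 2) * Real.exp (-(K * t)) - η * t)
    (f' := fun t => (2 * (u₁ t - u₂ t) * (((u₁ t ^ 2 + v₁ t ^ 2 - α₁) * v₁ t - u₁ t / t) -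
        ((u₂ t ^ 2 + v₂ t ^ 2 - α₂) * v₂ t - u₂ t / t)) +
      2 * (v₁ t - v₂ t) * (-(u₁ t ^ 2 + v₁ t ^ 2 + β₁) * u₁ t -
        -(u₂ t ^ 2 + v₂ t ^ 2 + β₂) * u₂ t) -
      K * ((u₁ t - u₂ t) ^ 2 + (v₁ t - v₂ t) ^ 2)) * Real.exp (-(K * t)) - η) hr.1
    (by fun_prop) (fun t ht => ?_) (fun t ht => ?_)
  · simp only [h₁.u_zero, h₁.v_zero, h₂.u_zero, h₂.v_zero] at key
    simp at key
    have h1 : ((u₁ r - u₂ r) ^ 2 + (v₁ r - v₂ r) ^ 2) * Real.exp (-(K * r)) ≤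
        (a₁ - a₂) ^ 2 + η * r := by linarith
    calc _ = ((u₁ r - u₂ r) ^ 2 + (v₁ r - v₂ r) ^ 2) * Real.exp (-(K * r)) *
          Real.exp (K * r) := by rw [mul_assoc, ← Real.exp_add]; simp
      _ ≤ _ := by gcongr
  · have hd := ((((h₁.hasDeriv_u t ht.1).sub (h₂.hasDeriv_u t ht.1)).pow 2).add
      (((h₁.hasDeriv_v t ht.1).sub (h₂.hasDeriv_v t ht.1)).pow 2)).mul
      (((hasDerivAt_id t).const_mul K).neg.exp)
    refine (hd.sub ((hasDerivAt_id t).const_mul η)).congr_deriv ?_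
    simp
    ring
  · have ht0 := ht.1
    have hb1 := hB₁ t ⟨ht.1.le, ht.2.le.trans hr.2⟩
    have hb2 := hB₂ t ⟨ht.1.le, ht.2.le.trans hr.2⟩
    have hE : Real.exp (-(K * t)) ≤ 1 := Real.exp_le_one_iff.2 (by
      have : 0 ≤ K := by positivity
      have : 0 ≤ K * t := by positivity
      linarith)
    have hE0 := Real.exp_pos (-(K * t))
    generalize Real.exp (-(K * t)) = E at hE hE0
    set x := u₁ t with hx
    set y := v₁ t
    set x' := u₂ t
    set y' := v₂ t
    have e1 : (2 * (x - x') * (((x ^ 2 + y ^ 2 - α₁) * y - x / t) -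
        ((x' ^ 2 + y' ^ 2 - α₂) * y' - x' / t)) +
      2 * (y - y') * (-(x ^ 2 + y ^ 2 + β₁) * x - -(x' ^ 2 + y' ^ 2 + β₂) * x') -
      K * ((x - x') ^ 2 + (y - y') ^ 2)) =
      2 * ((x - x') * (x + x') + (y - y') * (y + y')) * (y' * (x - x') - x' * (y - y'))
      - 2 * (α₁ + β₁) * (x - x') * (y - y') - 2 * (α₁ - α₂) * y' * (x - x')
      - 2 * (β₁ - β₂) * x' * (y - y') - 2 * (x - x') ^ 2 / t
      - K * ((x - x') ^ 2 + (y - y') ^ 2) := by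
      field_simp
      ring
    have e2 : 2 * ((x - x') * (x + x') + (y - y') * (y + y')) *
        (y' * (x - x') - x' * (y - y')) ≤ 4 * B * ((x - x') ^ 2 + (y - y') ^ 2) := by
      have c1 : ((x - x') * (x + x') + (y - y') * (y + y')) ^ 2 ≤
          4 * B * ((x - x') ^ 2 + (y - y') ^ 2) := by
        have d1 : ((x - x') * (x + x') + (y - y') * (y + y')) ^ 2 ≤
          ((x + x') ^ 2 + (y + y') ^ 2) * ((x - x') ^ 2 + (y - y') ^ 2) := by
          linear_combination sq_nonneg ((x - x') * (y + y') - (y - y') * (x + x'))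
        have d2 : (x + x') ^ 2 + (y + y') ^ 2 ≤ 4 * B := by
          nlinarith [sq_nonneg (x - x'), sq_nonneg (y - y')]
        exact d1.trans (by gcongr)
      have c2 : (y' * (x - x') - x' * (y - y')) ^ 2 ≤ B * ((x - x') ^ 2 + (y - y') ^ 2) := by
        have d1 : (y' * (x - x') - x' * (y - y')) ^ 2 ≤
          (x' ^ 2 + y' ^ 2) * ((x - x') ^ 2 + (y - y') ^ 2) := by
          linear_combination sq_nonneg (x' * (x - x') + y' * (y - y'))
        exact d1.trans (by gcongr)
      -- This is `2 P Q ≤ P² / 2 + 2 Q²`, weighted so that `P² ≤ 4 B d` and `Q² ≤ B d` contribute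
      -- equally.
      linear_combination sq_nonneg (((x - x') * (x + x') + (y - y') * (y + y')) -
        2 * (y' * (x - x') - x' * (y - y'))) / 2 + c1 / 2 + 2 * c2
    have e3 : -(2 * (α₁ + β₁) * (x - x') * (y - y')) ≤
        (α₁ + β₁) * ((x - x') ^ 2 + (y - y') ^ 2) := by
      linear_combination mul_nonneg (add_nonneg hα₁ hβ₁) (sq_nonneg ((x - x') + (y - y')))
    have e4 : -(2 * (α₁ - α₂) * y' * (x - x')) ≤ (x - x') ^ 2 + (α₁ - α₂) ^ 2 * B := by
      have : (α₁ - α₂) ^ 2 * y' ^ 2 ≤ (α₁ - α₂) ^ 2 * B := by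
        gcongr; linarith [sq_nonneg x']
      linear_combination this + sq_nonneg ((α₁ - α₂) * y' + (x - x'))
    have e5 : -(2 * (β₁ - β₂) * x' * (y - y')) ≤ (y - y') ^ 2 + (β₁ - β₂) ^ 2 * B := by
      have : (β₁ - β₂) ^ 2 * x' ^ 2 ≤ (β₁ - β₂) ^ 2 * B := by
        gcongr; linarith [sq_nonneg y']
      linear_combination this + sq_nonneg ((β₁ - β₂) * x' + (y - y'))
    have e6 : 0 ≤ 2 * (x - x') ^ 2 / t := by positivity
    have e7 : (2 * (x - x') * (((x ^ 2 + y ^ 2 - α₁) * y - x / t) -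
        ((x' ^ 2 + y' ^ 2 - α₂) * y' - x' / t)) +
      2 * (y - y') * (-(x ^ 2 + y ^ 2 + β₁) * x - -(x' ^ 2 + y' ^ 2 + β₂) * x') -
      K * ((x - x') ^ 2 + (y - y') ^ 2)) ≤ η := by
      rw [e1, hK, hη]
      linarith
    have e8 := mul_le_mul_of_nonneg_right e7 hE0.le
    have e9 := mul_le_mul_of_nonneg_left hE hη0
    linarith
end RadialFlow

/-! ### Global existence: Volterra equation and truncation -/

section Volterra

variable {E : Type*} [NormedAddCommGroup E] [NormedSpace ℝ E]

/-- The integral operator `w ↦ a + |r| ∫₀¹ Φ(τ, w(|r| τ)) dτ`. -/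
noncomputable def volterra (Φ : ℝ → E → E) (a : E) (w : ℝ → E) (r : ℝ) : E :=
  a + |r| • ∫ τ in (0 : ℝ)..1, Φ τ (w (|r| * τ))

theorem continuous_volterra {Φ : ℝ → E → E} (hΦ : Continuous (Function.uncurry Φ)) (a : E)
    {w : ℝ → E} (hw : Continuous w) : Continuous (volterra Φ a w) := by
  unfold volterra
  have : Continuous (Function.uncurry fun r τ : ℝ => Φ τ (w (|r| * τ))) :=
    hΦ.comp (by fun_prop : Continuous fun p : ℝ × ℝ => (p.2, w (|p.1| * p.2)))
  have := intervalIntegral.continuous_parametric_intervalIntegral_of_continuous'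
    (μ := MeasureTheory.volume) this 0 1
  fun_prop

theorem mul_integral_exp_le {K x : ℝ} (hK : 0 < K) :
    x * ∫ τ in (0 : ℝ)..1, Real.exp (K * (x * τ)) ≤ Real.exp (K * x) / K := by
  have h1 : ∀ τ ∈ Set.uIcc (0 : ℝ) 1,
      HasDerivAt (fun τ => Real.exp (K * (x * τ)) / K) (x * Real.exp (K * (x * τ))) τ := by
    intro τ _
    refine (((((hasDerivAt_id τ).const_mul x).const_mul K).exp).div_const K).congr_deriv ?_
    simp
    field_simp
  have h2 := intervalIntegral.integral_eq_sub_of_hasDerivAt h1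
    (Continuous.intervalIntegrable (by fun_prop) _ _)
  rw [intervalIntegral.integral_const_mul] at h2
  rw [h2]
  simp
  positivity

/-- Integrating the weight `exp (2 L |r|)` gains `1 / (2 L)` against the Lipschitz constant `L`. The
contraction factor `1 / 2` is therefore uniform on the whole line. -/
theorem norm_volterra_sub_le {Φ : ℝ → E → E} (hΦ : Continuous (Function.uncurry Φ)) {L : ℝ}
    (hL : 0 < L) (hlip : ∀ τ ∈ Set.Icc (0 : ℝ) 1, ∀ x y, ‖Φ τ x - Φ τ y‖ ≤ L * ‖x - y‖) (a : E)
    {w₁ w₂ : ℝ → E} (h₁ : Continuous w₁) (h₂ : Continuous w₂) {C : ℝ}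
    (hC : ∀ t, ‖w₁ t - w₂ t‖ ≤ C * Real.exp (2 * L * |t|)) (r : ℝ) :
    ‖volterra Φ a w₁ r - volterra Φ a w₂ r‖ ≤ C / 2 * Real.exp (2 * L * |r|) := by
  have hC0 : 0 ≤ C := by
    have := (norm_nonneg _).trans (hC 0)
    simpa using this
  have hi : ∀ {w : ℝ → E}, Continuous w →
      IntervalIntegrable (fun τ => Φ τ (w (|r| * τ))) MeasureTheory.volume 0 1 := fun hw =>
    (hΦ.comp (by fun_prop : Continuous fun τ : ℝ => (τ, _))).intervalIntegrable _ _
  unfold volterra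
  rw [add_sub_add_left_eq_sub, ← smul_sub, ← intervalIntegral.integral_sub (hi h₁) (hi h₂),
    norm_smul, norm_abs_eq_norm, Real.norm_eq_abs]
  have hb : ‖∫ τ in (0 : ℝ)..1, (Φ τ (w₁ (|r| * τ)) - Φ τ (w₂ (|r| * τ)))‖ ≤
      ∫ τ in (0 : ℝ)..1, L * C * Real.exp (2 * L * (|r| * τ)) := by
    refine intervalIntegral.norm_integral_le_of_norm_le zero_le_one ?_
      (Continuous.intervalIntegrable (by fun_prop) _ _)
    refine Eventually.of_forall fun τ hτ => ?_
    refine (hlip τ ⟨hτ.1.le, hτ.2⟩ _ _).trans ?_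
    have := hC (|r| * τ)
    rw [abs_of_nonneg (mul_nonneg (abs_nonneg r) hτ.1.le)] at this
    rw [mul_assoc]
    gcongr
  rw [intervalIntegral.integral_const_mul] at hb
  calc _ ≤ |r| * (L * C * ∫ τ in (0 : ℝ)..1, Real.exp (2 * L * (|r| * τ))) := by gcongr
    _ = L * C * (|r| * ∫ τ in (0 : ℝ)..1, Real.exp (2 * L * (|r| * τ))) := by ring
    _ ≤ L * C * (Real.exp (2 * L * |r|) / (2 * L)) := by
      gcongr
      exact mul_integral_exp_le (by positivity)
    _ = _ := by field_simp

/-- Global solvability of the Volterra equation with a Lipschitz nonlinearity. -/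
theorem exists_eq_volterra [CompleteSpace E] {Φ : ℝ → E → E}
    (hΦ : Continuous (Function.uncurry Φ)) {L : ℝ}
    (hL : 0 < L) (hlip : ∀ τ ∈ Set.Icc (0 : ℝ) 1, ∀ x y, ‖Φ τ x - Φ τ y‖ ≤ L * ‖x - y‖)
    (h0 : ∀ τ, Φ τ 0 = 0) (a : E) :
    ∃ w : ℝ → E, Continuous w ∧ ∀ r, w r = volterra Φ a w r := by
  -- The fixed point is sought among bounded functions multiplied by the exponential weight, so no
  -- continuation from local solutions is needed.
  let W : BoundedContinuousFunction ℝ E → ℝ → E := fun w t => Real.exp (2 * L * |t|) • w t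
  have hW : ∀ w, Continuous (W w) := fun w => by
    have := w.continuous
    fun_prop
  have hS : ∀ w, Continuous fun r => Real.exp (-(2 * L * |r|)) • volterra Φ a (W w) r := fun w => by
    have := continuous_volterra hΦ a (hW w)
    fun_prop
  have hdist : ∀ w₁ w₂ : BoundedContinuousFunction ℝ E, ∀ r,
      ‖Real.exp (-(2 * L * |r|)) • volterra Φ a (W w₁) r -
        Real.exp (-(2 * L * |r|)) • volterra Φ a (W w₂) r‖ ≤ ‖w₁ - w₂‖ / 2 := by
    intro w₁ w₂ r
    rw [← smul_sub, norm_smul, Real.norm_eq_abs, Real.abs_exp]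
    have := norm_volterra_sub_le hΦ hL hlip a (hW w₁) (hW w₂) (C := ‖w₁ - w₂‖) (fun t => by
      simp only [W]
      rw [← smul_sub, norm_smul, Real.norm_eq_abs, Real.abs_exp, mul_comm]
      gcongr
      exact (w₁ - w₂).norm_coe_le_norm t) r
    calc _ ≤ Real.exp (-(2 * L * |r|)) * (‖w₁ - w₂‖ / 2 * Real.exp (2 * L * |r|)) := by gcongr
      _ = ‖w₁ - w₂‖ / 2 * (Real.exp (-(2 * L * |r|)) * Real.exp (2 * L * |r|)) := by ring
      _ = _ := by rw [← Real.exp_add]; simp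
  have hbd : ∀ w r, ‖Real.exp (-(2 * L * |r|)) • volterra Φ a (W w) r‖ ≤ ‖a‖ + ‖w‖ / 2 := by
    intro w r
    have h1 := hdist w 0 r
    have h2 : volterra Φ a (W 0) r = a := by simp [volterra, W, h0]
    rw [h2, sub_zero] at h1
    have h3 : ‖Real.exp (-(2 * L * |r|)) • a‖ ≤ ‖a‖ := by
      rw [norm_smul, Real.norm_eq_abs, Real.abs_exp]
      refine mul_le_of_le_one_left (norm_nonneg _) (Real.exp_le_one_iff.2 ?_)
      have : 0 ≤ 2 * L * |r| := by positivity
      linarith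
    have h4 := norm_sub_norm_le (Real.exp (-(2 * L * |r|)) • volterra Φ a (W w) r)
      (Real.exp (-(2 * L * |r|)) • a)
    linarith
  let T : BoundedContinuousFunction ℝ E → BoundedContinuousFunction ℝ E := fun w =>
    BoundedContinuousFunction.ofNormedAddCommGroup _ (hS w) (‖a‖ + ‖w‖ / 2) (hbd w)
  have hT : ContractingWith (1 / 2) T := by
    refine ⟨by rw [← NNReal.coe_lt_coe]; norm_num, LipschitzWith.of_dist_le_mul fun w₁ w₂ => ?_⟩
    rw [dist_eq_norm w₁ w₂]
    refine (BoundedContinuousFunction.dist_le (by positivity)).2 fun r => ?_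
    rw [dist_eq_norm]
    refine (hdist w₁ w₂ r).trans (le_of_eq ?_)
    push_cast
    ring
  refine ⟨W (hT.fixedPoint T), hW _, fun r => ?_⟩
  have h1 : T (hT.fixedPoint T) r = hT.fixedPoint T r := by rw [hT.fixedPoint_isFixedPt]
  simp only [W]
  rw [← h1]
  simp only [T, BoundedContinuousFunction.coe_ofNormedAddCommGroup, smul_smul, ← Real.exp_add]
  simp [W]

end Volterra

section Cutoff

/-- The truncation `min(|w|, M)²` of `|w|²`. -/
noncomputable def cutoff (M : ℝ) (w : ℂ) : ℝ := (min ‖w‖ M) ^ 2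

theorem continuous_cutoff (M : ℝ) : Continuous (cutoff M) := by
  unfold cutoff
  fun_prop

/-- The difference of the cutoffs is made to multiply the shorter vector `x`: either `‖x‖ ≥ M` and
the cutoffs agree, or `‖x‖ ≤ M`. -/
theorem norm_cutoff_smul_sub_le {M : ℝ} (hM : 0 ≤ M) (x y : ℂ) :
    ‖cutoff M x • x - cutoff M y • y‖ ≤ 3 * M ^ 2 * ‖x - y‖ := by
  wlog hxy : ‖x‖ ≤ ‖y‖ generalizing x y
  · rw [norm_sub_rev, norm_sub_rev x]
    exact this y x (le_of_not_ge hxy)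
  have h1 : cutoff M x • x - cutoff M y • y =
      cutoff M y • (x - y) + (cutoff M x - cutoff M y) • x := by
    rw [smul_sub, sub_smul]; abel
  have hmx : 0 ≤ min ‖x‖ M := le_min (norm_nonneg _) hM
  have hmy : 0 ≤ min ‖y‖ M := le_min (norm_nonneg _) hM
  have h2 : ‖cutoff M y • (x - y)‖ ≤ M ^ 2 * ‖x - y‖ := by
    rw [norm_smul, Real.norm_eq_abs, cutoff, abs_of_nonneg (by positivity)]
    gcongr
    exact min_le_right _ _
  have h3 : ‖(cutoff M x - cutoff M y) • x‖ ≤ 2 * M ^ 2 * ‖x - y‖ := by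
    rw [norm_smul, Real.norm_eq_abs, cutoff, cutoff]
    rcases le_total M ‖x‖ with hx | hx
    · rw [min_eq_right hx, min_eq_right (hx.trans hxy)]
      simp
      positivity
    · have h4 : |min ‖x‖ M - min ‖y‖ M| ≤ ‖x - y‖ := by
        refine (abs_min_sub_min_le_max _ _ _ _).trans ?_
        rw [sub_self, abs_zero, max_eq_left (abs_nonneg _)]
        exact abs_norm_sub_norm_le x y
      have h5 : |min ‖x‖ M + min ‖y‖ M| ≤ 2 * M := by
        rw [abs_of_nonneg (by positivity)]
        linarith [min_le_right ‖x‖ M, min_le_right ‖y‖ M]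
      rw [sq_sub_sq, abs_mul]
      calc _ ≤ 2 * M * ‖x - y‖ * M := by gcongr
        _ = _ := by ring
  rw [h1]
  refine (norm_add_le _ _).trans ?_
  linarith

/-- The right-hand side of the truncated system for `w = v + i u`. -/
noncomputable def cutoffField (α β M τ : ℝ) (w : ℂ) : ℂ :=
  -- The equation `(r u)' = r f` integrates to `u(r) = r ∫₀¹ τ f(r τ) dτ`: the singularity `1 / r`
  -- becomes the bounded factor `τ`.
  ⟨-(cutoff M w + β) * w.im, τ * ((cutoff M w - α) * w.re)⟩

theorem continuous_cutoffField (α β M : ℝ) :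
    Continuous (Function.uncurry (cutoffField α β M)) := by
  have := continuous_cutoff M
  have h1 : Continuous fun p : ℝ × ℂ =>
      ((-(cutoff M p.2 + β) * p.2.im : ℝ) : ℂ) +
        ((p.1 * ((cutoff M p.2 - α) * p.2.re) : ℝ) : ℂ) * Complex.I := by fun_prop
  convert h1 using 2 with p
  simp only [Function.uncurry, cutoffField]
  apply Complex.ext <;> simp

theorem norm_cutoffField_sub_le {α β M : ℝ} (hα : 0 ≤ α) (hβ : 0 ≤ β) (hM : 0 ≤ M) {τ : ℝ}
    (hτ : τ ∈ Set.Icc (0 : ℝ) 1) (x y : ℂ) :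
    ‖cutoffField α β M τ x - cutoffField α β M τ y‖ ≤ (6 * M ^ 2 + α + β) * ‖x - y‖ := by
  have h := norm_cutoff_smul_sub_le hM x y
  set n := cutoff M x • x - cutoff M y • y with hn
  have hre : n.re = cutoff M x * x.re - cutoff M y * y.re := by simp [hn]
  have him : n.im = cutoff M x * x.im - cutoff M y * y.im := by simp [hn]
  have b1 := (Complex.abs_re_le_norm n).trans h
  have b2 := (Complex.abs_im_le_norm n).trans h
  have b3 := Complex.abs_re_le_norm (x - y)
  have b4 := Complex.abs_im_le_norm (x - y)
  refine (Complex.norm_le_abs_re_add_abs_im _).trans ?_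
  have e1 : (cutoffField α β M τ x - cutoffField α β M τ y).re = -(n.im + β * (x - y).im) := by
    rw [him]; simp [cutoffField]; ring
  have e2 : (cutoffField α β M τ x - cutoffField α β M τ y).im =
      τ * (n.re - α * (x - y).re) := by
    rw [hre]; simp [cutoffField]; ring
  rw [e1, e2, abs_neg, abs_mul, abs_of_nonneg hτ.1]
  have c1 : |n.im + β * (x - y).im| ≤ 3 * M ^ 2 * ‖x - y‖ + β * ‖x - y‖ := by
    refine (abs_add_le _ _).trans ?_
    rw [abs_mul, abs_of_nonneg hβ]
    gcongr
  have c2 : |n.re - α * (x - y).re| ≤ 3 * M ^ 2 * ‖x - y‖ + α * ‖x - y‖ := by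
    refine (abs_sub _ _).trans ?_
    rw [abs_mul, abs_of_nonneg hα]
    gcongr
  have c3 : τ * |n.re - α * (x - y).re| ≤ |n.re - α * (x - y).re| :=
    mul_le_of_le_one_left (abs_nonneg _) hτ.2
  linarith

end Cutoff

theorem cutoff_eq_of_normSq_le {M : ℝ} (hM : 0 ≤ M) {w : ℂ} (h : w.im ^ 2 + w.re ^ 2 ≤ M ^ 2) :
    cutoff M w = w.im ^ 2 + w.re ^ 2 := by
  have h1 : ‖w‖ ^ 2 = w.im ^ 2 + w.re ^ 2 := by
    rw [Complex.sq_norm, Complex.normSq_apply]; ring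
  have h2 : ‖w‖ ≤ M := by
    rw [← h1] at h
    exact (sq_le_sq₀ (norm_nonneg _) hM).1 h
  rw [cutoff, min_eq_left h2, h1]

/-- The truncated radial system has a global solution. -/
theorem exists_cutoff_flow {α β M : ℝ} (hα : 0 ≤ α) (hβ : 0 ≤ β) (hM : 0 < M) (a : ℝ) :
    ∃ (w : ℝ → ℂ) (J : ℝ → ℝ), Continuous w ∧ w 0 = a ∧ Continuous J ∧
      (∀ r, 0 ≤ r → (w r).im = r * J r) ∧
      (∀ r, 0 < r → HasDerivAt (fun r => (w r).im)
        ((cutoff M (w r) - α) * (w r).re - (w r).im / r) r) ∧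
      (∀ r, 0 < r → HasDerivAt (fun r => (w r).re) (-(cutoff M (w r) + β) * (w r).im) r) := by
  obtain ⟨w, hwc, hw⟩ := exists_eq_volterra (continuous_cutoffField α β M)
    (L := 6 * M ^ 2 + α + β) (by positivity)
    (fun τ hτ x y => norm_cutoffField_sub_le hα hβ hM.le hτ x y)
    (fun τ => by apply Complex.ext <;> simp [cutoffField]) (a : ℂ)
  have hcut := (continuous_cutoff M).comp hwc
  set f : ℝ → ℝ := fun t => (cutoff M (w t) - α) * (w t).re with hf
  set g : ℝ → ℝ := fun t => -(cutoff M (w t) + β) * (w t).im with hg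
  have hfc : Continuous f := by
    simp only [Function.comp_def] at hcut
    fun_prop
  have hgc : Continuous g := by
    simp only [Function.comp_def] at hcut
    fun_prop
  have hint : ∀ r : ℝ, IntervalIntegrable (fun τ => cutoffField α β M τ (w (|r| * τ)))
      MeasureTheory.volume 0 1 := fun r =>
    ((continuous_cutoffField α β M).comp
      (by fun_prop : Continuous fun τ : ℝ => (τ, w (|r| * τ)))).intervalIntegrable _ _
  have hre : ∀ r, 0 ≤ r → (w r).re = a + ∫ t in (0 : ℝ)..r, g t := by
    intro r hr
    have h1 := congrArg Complex.reCLM (hw r)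
    rw [volterra, map_add, map_smul, ← ContinuousLinearMap.intervalIntegral_comp_comm _ (hint r),
      abs_of_nonneg hr] at h1
    have h2 := intervalIntegral.smul_integral_comp_mul_left (a := 0) (b := 1) g r
    simp only [mul_zero, mul_one] at h2
    rw [← h2]
    simpa [cutoffField, hg] using h1
  have him : ∀ r, 0 ≤ r → (w r).im = r * ∫ τ in (0 : ℝ)..1, τ * f (|r| * τ) := by
    intro r hr
    have h1 := congrArg Complex.imCLM (hw r)
    rw [volterra, map_add, map_smul, ← ContinuousLinearMap.intervalIntegral_comp_comm _ (hint r)]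
      at h1
    rw [abs_of_nonneg hr] at h1 ⊢
    simpa [cutoffField, hf] using h1
  have him' : ∀ r, 0 < r → (w r).im = (∫ t in (0 : ℝ)..r, t * f t) / r := by
    intro r hr
    have h2 := intervalIntegral.smul_integral_comp_mul_left (a := 0) (b := 1)
      (fun t => t * f t) r
    simp only [mul_zero, mul_one, smul_eq_mul, mul_assoc] at h2
    rw [intervalIntegral.integral_const_mul] at h2
    rw [him r hr.le, abs_of_pos hr, ← h2]
    field_simp
  refine ⟨w, fun r => ∫ τ in (0 : ℝ)..1, τ * f (|r| * τ), hwc, ?_, ?_, him, ?_, ?_⟩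
  · rw [hw 0]; simp [volterra]
  · exact intervalIntegral.continuous_parametric_intervalIntegral_of_continuous'
      (by fun_prop : Continuous (Function.uncurry fun r τ : ℝ => τ * f (|r| * τ))) 0 1
  · intro r hr
    have hd : HasDerivAt (fun r => ∫ t in (0 : ℝ)..r, t * f t) (r * f r) r := by
      have hc : Continuous fun t => t * f t := by fun_prop
      exact intervalIntegral.integral_hasDerivAt_right (hc.intervalIntegrable _ _)
        (hc.stronglyMeasurableAtFilter _ _) hc.continuousAt
    have h1 := (hd.div (hasDerivAt_id r) hr.ne').congr_of_eventuallyEq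
      (f₁ := fun r => (w r).im) (by
        filter_upwards [lt_mem_nhds hr] with t ht
        simpa using him' t ht)
    refine h1.congr_deriv ?_
    rw [him' r hr]
    simp only [id, hf]
    field_simp
  · intro r hr
    have hd : HasDerivAt (fun r => ∫ t in (0 : ℝ)..r, g t) (g r) r :=
      intervalIntegral.integral_hasDerivAt_right (hgc.intervalIntegrable _ _)
        (hgc.stronglyMeasurableAtFilter _ _) hgc.continuousAt
    exact (hd.const_add a).congr_of_eventuallyEq (by
        filter_upwards [lt_mem_nhds hr] with t ht
        exact hre t ht.le)

/-- Global existence; moreover `u(r) / r` extends continuously to `r = 0`. -/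
theorem exists_radialFlow {α β : ℝ} (hα : 0 ≤ α) (hβ : 0 ≤ β) (a : ℝ) :
    ∃ u v J : ℝ → ℝ, RadialFlow α β a u v ∧ Continuous v ∧ Continuous J ∧
      ∀ r, 0 ≤ r → u r = r * J r := by
  -- The `+ 1` puts the truncation level strictly above the a priori bound `a² + 2α`, so that
  -- continuous induction shows the cutoff is never active.
  set M := √(a ^ 2 + 2 * α + 1) with hM
  have hM0 : 0 < M := Real.sqrt_pos.2 (by positivity)
  have hM2 : M ^ 2 = a ^ 2 + 2 * α + 1 := Real.sq_sqrt (by positivity)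
  obtain ⟨w, J, hwc, hw0, hJ, hu, hdu, hdv⟩ := exists_cutoff_flow hα hβ hM0 a
  have hbd : ∀ r, 0 ≤ r → (w r).im ^ 2 + (w r).re ^ 2 < M ^ 2 := by
    intro R hR
    have key := pos_on_Icc_of_propagates (f := fun r => M ^ 2 - ((w r).im ^ 2 + (w r).re ^ 2))
      (a := 0) (b := R) (by fun_prop) (fun r hr h => ?_) R ⟨hR, le_rfl⟩
    · linarith
    · have h1 := le_of_hasDerivAt_nonpos (f := fun r => hamiltonian α β (w r).im (w r).re)
        (f' := fun r => -((w r).im ^ 2 / r * ((w r).im ^ 2 + (w r).re ^ 2 + β))) hr.1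
        (by unfold hamiltonian; fun_prop) (fun t ht => ?_) (fun t ht => ?_)
      · simp only [hw0, Complex.ofReal_im, Complex.ofReal_re] at h1
        have := normSq_le_of_hamiltonian_le hα hβ h1
        linarith
      · have h2 := cutoff_eq_of_normSq_le hM0.le (sub_pos.1 (h t ⟨ht.1.le, ht.2⟩)).le
        refine hasDerivAt_hamiltonian ht.1 ?_ ?_
        · exact h2 ▸ hdu t ht.1
        · exact h2 ▸ hdv t ht.1
      · have := ht.1
        rw [neg_nonpos]
        positivity
  refine ⟨fun r => (w r).im, fun r => (w r).re, J, ⟨?_, ?_, ?_, ?_, ?_, ?_⟩, ?_, hJ, hu⟩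
  · exact Continuous.continuousOn (by fun_prop)
  · exact Continuous.continuousOn (by fun_prop)
  · simp [hw0]
  · simp [hw0]
  · intro r hr
    exact cutoff_eq_of_normSq_le hM0.le (hbd r hr.le).le ▸ hdu r hr
  · intro r hr
    exact cutoff_eq_of_normSq_le hM0.le (hbd r hr.le).le ▸ hdv r hr
  · fun_prop

/-! ### Smoothness up to the origin in the variable `s = r²` -/

/-- A derivative on `(0, ∞)` which is continuous up to `0` is a one-sided derivative at `0`. -/
theorem hasDerivWithinAt_Ici_of_hasDerivAt {f g : ℝ → ℝ} (hf : ContinuousOn f (Set.Ici 0))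
    (hd : ∀ s, 0 < s → HasDerivAt f (g s) s) (hg : ContinuousOn g (Set.Ici 0)) {s : ℝ}
    (hs : 0 ≤ s) : HasDerivWithinAt f (g s) (Set.Ici 0) s := by
  rcases hs.eq_or_lt with rfl | hs
  · refine hasDerivWithinAt_Ici_of_tendsto_deriv (s := Set.Ioi 0)
      (fun x hx => (hd x hx).differentiableAt.differentiableWithinAt)
      ((hf 0 Set.self_mem_Ici).mono Set.Ioi_subset_Ici_self) self_mem_nhdsWithin ?_
    have h1 : Tendsto g (𝓝[>] 0) (𝓝 (g 0)) :=
      (hg 0 Set.self_mem_Ici).mono_left (nhdsWithin_mono _ Set.Ioi_subset_Ici_self)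
    exact h1.congr' (by
      filter_upwards [self_mem_nhdsWithin] with x hx
      exact (hd x hx).deriv.symm)
  · exact (hd s hs).hasDerivWithinAt

theorem contDiffOn_succ_Ici {n : ℕ} {f g : ℝ → ℝ} (hf : ContinuousOn f (Set.Ici 0))
    (hd : ∀ s, 0 < s → HasDerivAt f (g s) s) (hg : ContDiffOn ℝ n g (Set.Ici 0)) :
    ContDiffOn ℝ (n + 1 : ℕ) f (Set.Ici 0) := by
  have h1 : ∀ s ∈ Set.Ici (0 : ℝ), HasDerivWithinAt f (g s) (Set.Ici 0) s := fun s hs =>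
    hasDerivWithinAt_Ici_of_hasDerivAt hf hd hg.continuousOn hs
  push_cast
  rw [contDiffOn_succ_iff_derivWithin (uniqueDiffOn_Ici 0)]
  refine ⟨fun s hs => (h1 s hs).differentiableWithinAt, by simp, hg.congr fun s hs => ?_⟩
  exact (h1 s hs).derivWithin (uniqueDiffOn_Ici 0 s hs)

/-- The averaged moments `∫₀¹ tᵏ h(s t) dt`. -/
noncomputable def moment (k : ℕ) (h : ℝ → ℝ) (s : ℝ) : ℝ :=
  ∫ t in (0 : ℝ)..1, t ^ k * h (s * t)

theorem continuous_comp_max {h : ℝ → ℝ} (hh : ContinuousOn h (Set.Ici 0)) :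
    Continuous fun x => h (max x 0) :=
  hh.comp_continuous (by fun_prop) fun x => le_max_right x 0

theorem continuousOn_moment (k : ℕ) {h : ℝ → ℝ} (hh : ContinuousOn h (Set.Ici 0)) :
    ContinuousOn (moment k h) (Set.Ici 0) := by
  have hc := continuous_comp_max hh
  have h1 : Continuous fun s => ∫ t in (0 : ℝ)..1, t ^ k * h (max (s * t) 0) :=
    intervalIntegral.continuous_parametric_intervalIntegral_of_continuous'
      ((by fun_prop : Continuous fun p : ℝ × ℝ => p.2 ^ k).mul
        (hc.comp (by fun_prop : Continuous fun p : ℝ × ℝ => p.1 * p.2))) 0 1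
  refine h1.continuousOn.congr fun s hs => intervalIntegral.integral_congr fun t ht => ?_
  rw [Set.uIcc_of_le zero_le_one] at ht
  simp only [max_eq_left (mul_nonneg (Set.mem_Ici.1 hs) ht.1)]

theorem pow_mul_moment (k : ℕ) (h : ℝ → ℝ) {s : ℝ} (hs : 0 ≤ s) :
    s ^ (k + 1) * moment k h s = ∫ t in (0 : ℝ)..s, t ^ k * h (max t 0) := by
  have h1 := intervalIntegral.smul_integral_comp_mul_left (a := 0) (b := 1)
    (fun t => t ^ k * h t) s
  simp only [mul_zero, mul_one, smul_eq_mul, mul_pow, mul_assoc] at h1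
  rw [intervalIntegral.integral_const_mul] at h1
  rw [moment, pow_succ', mul_assoc, h1]
  refine intervalIntegral.integral_congr fun t ht => ?_
  rw [Set.uIcc_of_le hs] at ht
  simp only [max_eq_left ht.1]

/-- On `(0, ∞)` the moment is `s^(-(k+1)) ∫₀ˢ tᵏ h`, to which the quotient rule applies; integration
by parts (`hparts`) identifies the result as the next moment of `h'`. -/
theorem hasDerivAt_moment (k : ℕ) {h g : ℝ → ℝ} (hh : ContinuousOn h (Set.Ici 0))
    (hd : ∀ s, 0 < s → HasDerivAt h (g s) s) (hg : ContinuousOn g (Set.Ici 0)) {s : ℝ}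
    (hs : 0 < s) : HasDerivAt (moment k h) (moment (k + 1) g s) s := by
  have hmaps : Set.MapsTo (fun t : ℝ => s * t) (Set.Icc 0 1) (Set.Ici 0) := fun t ht =>
    mul_nonneg hs.le ht.1
  have hch : ContinuousOn (fun t => h (s * t)) (Set.Icc 0 1) := hh.comp (by fun_prop) hmaps
  have hcg : ContinuousOn (fun t => g (s * t)) (Set.Icc 0 1) := hg.comp (by fun_prop) hmaps
  have hi : IntervalIntegrable (fun t => t ^ k * h (s * t)) MeasureTheory.volume 0 1 :=
    ContinuousOn.intervalIntegrable_of_Icc zero_le_one (by fun_prop)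
  have hi' : IntervalIntegrable (fun t => t ^ (k + 1) * g (s * t)) MeasureTheory.volume 0 1 :=
    ContinuousOn.intervalIntegrable_of_Icc zero_le_one (by fun_prop)
  have hparts : ((k + 1 : ℕ) : ℝ) * moment k h s + s * moment (k + 1) g s = h s := by
    have := intervalIntegral.integral_eq_sub_of_hasDerivAt_of_le zero_le_one
      (f := fun t => t ^ (k + 1) * h (s * t))
      (f' := fun t => ((k + 1 : ℕ) : ℝ) * (t ^ k * h (s * t)) + s * (t ^ (k + 1) * g (s * t)))
      (by fun_prop) (fun t ht => by
        refine ((hasDerivAt_pow (k + 1) t).mul ((hd (s * t) (mul_pos hs ht.1)).comp t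
          ((hasDerivAt_id t).const_mul s))).congr_deriv ?_
        simp
        ring) ((hi.const_mul _).add (hi'.const_mul _))
    rw [intervalIntegral.integral_add (hi.const_mul _) (hi'.const_mul _),
      intervalIntegral.integral_const_mul, intervalIntegral.integral_const_mul] at this
    simpa [moment] using this
  have hc : Continuous fun t => t ^ k * h (max t 0) :=
    (continuous_pow k).mul (continuous_comp_max hh)
  have hF : HasDerivAt (fun s => ∫ t in (0 : ℝ)..s, t ^ k * h (max t 0))
      (s ^ k * h (max s 0)) s :=
    intervalIntegral.integral_hasDerivAt_right (hc.intervalIntegrable _ _)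
      (hc.stronglyMeasurableAtFilter _ _) hc.continuousAt
  have h1 := (hF.div (hasDerivAt_pow (k + 1) s) (by positivity)).congr_of_eventuallyEq
    (f₁ := moment k h) (by
      filter_upwards [lt_mem_nhds hs] with t ht
      rw [Pi.div_apply, ← pow_mul_moment k h ht.le]
      field_simp)
  refine h1.congr_deriv ?_
  rw [← pow_mul_moment k h hs.le, max_eq_left hs.le, ← hparts]
  simp
  field_simp
  ring

/-- Averaging loses no regularity. The induction runs over all `k` at once because each derivative
raises the moment index. -/
theorem contDiffOn_moment (n : ℕ) : ∀ (k : ℕ) {h : ℝ → ℝ}, ContDiffOn ℝ n h (Set.Ici 0) →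
    ContDiffOn ℝ n (moment k h) (Set.Ici 0) := by
  induction n with
  | zero =>
    intro k h hh
    simp only [Nat.cast_zero, contDiffOn_zero] at hh ⊢
    exact continuousOn_moment k hh
  | succ n ih =>
    intro k h hh
    have hh' := hh
    push_cast at hh'
    rw [contDiffOn_succ_iff_derivWithin (uniqueDiffOn_Ici 0)] at hh'
    obtain ⟨hdiff, -, hg⟩ := hh'
    refine contDiffOn_succ_Ici (continuousOn_moment k hh.continuousOn) (fun s hs => ?_)
      (ih (k + 1) hg)
    refine hasDerivAt_moment k hh.continuousOn (fun t ht => ?_) hg.continuousOn hs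
    exact (hdiff t ht.le).hasDerivWithinAt.hasDerivAt (Ici_mem_nhds ht)

/-- The radial system in the variable `s = r²`, with `u(r) = r U(r²)` and `v(r) = V(r²)`. -/
structure SquaredFlow (α β : ℝ) (U V : ℝ → ℝ) : Prop where
  cont_U : ContinuousOn U (Set.Ici 0)
  cont_V : ContinuousOn V (Set.Ici 0)
  hasDeriv_U : ∀ s, 0 < s →
    HasDerivAt U (((s * U s ^ 2 + V s ^ 2 - α) * V s - 2 * U s) / (2 * s)) s
  hasDeriv_V : ∀ s, 0 < s → HasDerivAt V (-(s * U s ^ 2 + V s ^ 2 + β) * U s / 2) s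

theorem RadialFlow.squaredFlow {α β a : ℝ} {u v J : ℝ → ℝ} (h : RadialFlow α β a u v)
    (hJ : Continuous J) (hu : ∀ r, 0 ≤ r → u r = r * J r) :
    SquaredFlow α β (fun s => J (√s)) (fun s => v (√s)) where
  cont_U := by fun_prop
  cont_V := h.cont_v.comp (by fun_prop) fun s _ => Real.sqrt_nonneg s
  hasDeriv_U s hs := by
    have hr : 0 < √s := Real.sqrt_pos.2 hs
    have hsq : √s ^ 2 = s := Real.sq_sqrt hs.le
    have hd := ((((h.hasDeriv_u _ hr).comp s (Real.hasDerivAt_sqrt hs.ne')).div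
      (Real.hasDerivAt_sqrt hs.ne') hr.ne')).congr_of_eventuallyEq (f₁ := fun s => J (√s)) (by
        filter_upwards [lt_mem_nhds hs] with t ht
        have : 0 < √t := Real.sqrt_pos.2 ht
        simp [hu _ this.le]
        field_simp)
    refine hd.congr_deriv ?_
    simp only [Function.comp, hu _ hr.le]
    generalize √s = r at *
    subst hsq
    field_simp
    ring
  hasDeriv_V s hs := by
    have hr : 0 < √s := Real.sqrt_pos.2 hs
    have hsq : √s ^ 2 = s := Real.sq_sqrt hs.le
    refine ((h.hasDeriv_v _ hr).comp s (Real.hasDerivAt_sqrt hs.ne')).congr_deriv ?_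
    simp only [hu _ hr.le]
    generalize √s = r at *
    subst hsq
    field_simp

namespace SquaredFlow

variable {α β : ℝ} {U V : ℝ → ℝ}

/-- The `U`-equation says `2 (s U)' = F` with `F` the cubic expression, so `2 U` is the mean of `F`
over `[0, s]`. This removes the factor `1 / s`; the endpoint follows by continuity. -/
theorem U_eq_moment (h : SquaredFlow α β U V) {s : ℝ} (hs : 0 ≤ s) :
    U s = moment 0 (fun s => (s * U s ^ 2 + V s ^ 2 - α) * V s) s / 2 := by
  have := h.cont_U
  have := h.cont_V
  have hF : ContinuousOn (fun s => (s * U s ^ 2 + V s ^ 2 - α) * V s) (Set.Ici 0) := by fun_prop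
  have hEq : Set.EqOn U (fun s => moment 0 (fun s => (s * U s ^ 2 + V s ^ 2 - α) * V s) s / 2)
      (Set.Ioi 0) := by
    intro s hs
    have hs : 0 < s := hs
    have h1 := pow_mul_moment 0 (fun s => (s * U s ^ 2 + V s ^ 2 - α) * V s) hs.le
    have h2 := intervalIntegral.integral_eq_sub_of_hasDerivAt_of_le hs.le
      (f := fun s => 2 * (s * U s))
      (f' := fun t => t ^ 0 * (fun s => (s * U s ^ 2 + V s ^ 2 - α) * V s) (max t 0))
      (ContinuousOn.mono (by fun_prop) Set.Icc_subset_Ici_self) (fun t ht => by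
        refine (((hasDerivAt_id t).mul (h.hasDeriv_U t ht.1)).const_mul 2).congr_deriv ?_
        have := ht.1
        simp only [id, max_eq_left ht.1.le]
        field_simp
        ring) (Continuous.intervalIntegrable (by
          have := continuous_comp_max hF
          fun_prop) _ _)
    rw [h2, zero_add, pow_one, zero_mul, mul_zero, sub_zero] at h1
    refine mul_left_cancel₀ hs.ne' ?_
    linarith
  refine hEq.of_subset_closure h.cont_U ((continuousOn_moment 0 hF).div_const 2)
    Set.Ioi_subset_Ici_self ?_ hs
  rw [closure_Ioi]

theorem contDiffOn_nat (h : SquaredFlow α β U V) (n : ℕ) :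
    ContDiffOn ℝ n U (Set.Ici 0) ∧ ContDiffOn ℝ n V (Set.Ici 0) := by
  induction n with
  | zero => simpa [contDiffOn_zero] using ⟨h.cont_U, h.cont_V⟩
  | succ n ih =>
    obtain ⟨hU, hV⟩ := ih
    have hcU := h.cont_U
    have hcV := h.cont_V
    have hV' : ContDiffOn ℝ (n + 1 : ℕ) V (Set.Ici 0) :=
      contDiffOn_succ_Ici hcV h.hasDeriv_V (by fun_prop)
    -- `U` is not yet known to gain a derivative, but `s U²` does: in `(s U²)' = U F - U²` the
    -- singular factor cancels. Then `F`, and with it its mean `2 U`, is one order smoother.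
    have hQ : ContDiffOn ℝ (n + 1 : ℕ) (fun s => s * U s ^ 2) (Set.Ici 0) := by
      refine contDiffOn_succ_Ici (g := fun s => U s * ((s * U s ^ 2 + V s ^ 2 - α) * V s) - U s ^ 2)
        (by fun_prop) (fun s hs => ?_) (by fun_prop)
      refine ((hasDerivAt_id s).mul ((h.hasDeriv_U s hs).pow 2)).congr_deriv ?_
      simp
      field_simp
      ring
    refine ⟨?_, hV'⟩
    have hF : ContDiffOn ℝ (n + 1 : ℕ) (fun s => (s * U s ^ 2 + V s ^ 2 - α) * V s)
        (Set.Ici 0) := by fun_prop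
    exact ((contDiffOn_moment _ 0 hF).div_const 2).congr fun s hs => h.U_eq_moment hs

theorem contDiffOn_U (h : SquaredFlow α β U V) :
    ContDiffOn ℝ (⊤ : ℕ∞) U (Set.Ici 0) := contDiffOn_infty.2 fun n => (h.contDiffOn_nat n).1

theorem contDiffOn_V (h : SquaredFlow α β U V) :
    ContDiffOn ℝ (⊤ : ℕ∞) V (Set.Ici 0) := contDiffOn_infty.2 fun n => (h.contDiffOn_nat n).2

theorem hasDerivWithinAt_V (h : SquaredFlow α β U V) {s : ℝ} (hs : 0 ≤ s) :
    HasDerivWithinAt V (-(s * U s ^ 2 + V s ^ 2 + β) * U s / 2) (Set.Ici 0) s := by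
  have := h.cont_U
  have := h.cont_V
  exact hasDerivWithinAt_Ici_of_hasDerivAt (g := fun s => -(s * U s ^ 2 + V s ^ 2 + β) * U s / 2)
    h.cont_V h.hasDeriv_V (by fun_prop) hs

theorem exists_hasDerivWithinAt_U (h : SquaredFlow α β U V) {s : ℝ} (hs : 0 ≤ s) :
    ∃ U', HasDerivWithinAt U U' (Set.Ici 0) s ∧
      2 * s * U' + 2 * U s = (s * U s ^ 2 + V s ^ 2 - α) * V s := by
  rcases hs.eq_or_lt with rfl | hs
  · refine ⟨_, ((h.contDiffOn_U.differentiableOn (by simp)) 0 Set.self_mem_Ici).hasDerivWithinAt, ?_⟩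
    have := h.U_eq_moment le_rfl
    simp [moment] at this ⊢
    linarith
  · refine ⟨_, (h.hasDeriv_U s hs).hasDerivWithinAt, ?_⟩
    field_simp
    ring

end SquaredFlow

/-! ### Large data change sign: scaling and the Pohozaev functional -/

theorem pos_on_Icc_of_nonneg_propagates {f : ℝ → ℝ} {a b : ℝ} (hc : ContinuousOn f (Set.Icc a b))
    (ha : 0 < f a) (h : ∀ r ∈ Set.Ioc a b, (∀ t ∈ Set.Icc a r, 0 ≤ f t) → 0 < f r) :
    ∀ r ∈ Set.Icc a b, 0 < f r := by
  refine pos_on_Icc_of_propagates hc fun r hr hpos => ?_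
  rcases hr.1.eq_or_lt with rfl | har
  · exact ha
  refine h r ⟨har, hr.2⟩ fun t ht => ?_
  rcases ht.2.lt_or_eq with htr | rfl
  · exact (hpos t ⟨ht.1, htr⟩).le
  -- A negative value at `t` would persist slightly to the left, where `f` is already positive.
  by_contra! hneg
  have h1 : ∀ᶠ s in 𝓝[Set.Icc a b] t, f s < 0 := (hc t hr).eventually (gt_mem_nhds hneg)
  have h2 : ∀ᶠ s in 𝓝[<] t, s ∈ Set.Ico a t := Ico_mem_nhdsLT har
  have h3 : ∀ᶠ s in 𝓝[<] t, s ∈ Set.Icc a b → f s < 0 :=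
    nhdsWithin_le_nhds (eventually_nhdsWithin_iff.1 h1)
  obtain ⟨s, hs1, hs2⟩ := (h2.and h3).exists
  have h4 := hs2 ⟨hs1.1, hs1.2.le.trans hr.2⟩
  have h5 := hpos s hs1
  linarith

/-- The explicit solution of the massless system. -/
theorem radialFlow_massless :
    RadialFlow 0 0 1 (fun r => 2 * r / (4 + r ^ 2)) (fun r => 4 / (4 + r ^ 2)) := by
  have h0 : ∀ r : ℝ, 4 + r ^ 2 ≠ 0 := fun r => by positivity
  have hd : ∀ r : ℝ, HasDerivAt (fun r : ℝ => 4 + r ^ 2) (2 * r) r := fun r => by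
    simpa using (hasDerivAt_pow 2 r).const_add 4
  refine ⟨?_, ?_, by simp, by norm_num, fun r hr => ?_, fun r hr => ?_⟩
  · exact Continuous.continuousOn (by fun_prop (disch := exact h0 _))
  · exact Continuous.continuousOn (by fun_prop (disch := exact h0 _))
  · refine (((hasDerivAt_id r).const_mul 2).div (hd r) (h0 r)).congr_deriv ?_
    simp only [id]
    field_simp
    ring
  · refine ((hasDerivAt_const r 4).div (hd r) (h0 r)).congr_deriv ?_
    field_simp
    ring

namespace RadialFlow

variable {α β a : ℝ} {u v : ℝ → ℝ}

/-- The cubic massless system is invariant under this scaling, so a large datum is traded for small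
mass parameters. -/
theorem rescale (h : RadialFlow α β a u v) (ha : 0 < a) :
    RadialFlow (α / a ^ 2) (β / a ^ 2) 1 (fun r => u (r / a ^ 2) / a)
      (fun r => v (r / a ^ 2) / a) := by
  have hmaps : Set.MapsTo (fun r : ℝ => r / a ^ 2) (Set.Ici 0) (Set.Ici 0) := fun r hr =>
    div_nonneg (Set.mem_Ici.1 hr) (by positivity)
  have hd : ∀ r : ℝ, HasDerivAt (fun r : ℝ => r / a ^ 2) (1 / a ^ 2) r := fun r =>
    (hasDerivAt_id r).div_const _
  refine ⟨(h.cont_u.comp (by fun_prop) hmaps).div_const a,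
    (h.cont_v.comp (by fun_prop) hmaps).div_const a, by simp [h.u_zero],
    by simp [h.v_zero, ha.ne'], fun r hr => ?_, fun r hr => ?_⟩
  · refine (((h.hasDeriv_u (r / a ^ 2) (by positivity)).comp r (hd r)).div_const a).congr_deriv ?_
    field_simp
  · refine (((h.hasDeriv_v (r / a ^ 2) (by positivity)).comp r (hd r)).div_const a).congr_deriv ?_
    field_simp

/-- The Pohozaev functional `r² H - r u v / 2`. -/
theorem hasDerivAt_pohozaev (h : RadialFlow α β a u v) {r : ℝ} (hr : 0 < r) :
    HasDerivAt (fun r => r ^ 2 * hamiltonian α β (u r) (v r) - r * (u r * v r) / 2)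
      (r / 2 * (β * u r ^ 2 - α * v r ^ 2)) r := by
  refine (((hasDerivAt_pow 2 r).mul (h.hasDerivAt_hamiltonian hr)).sub
    (((hasDerivAt_id r).mul ((h.hasDeriv_u r hr).mul (h.hasDeriv_v r hr))).div_const 2)).congr_deriv
    ?_
  simp only [hamiltonian, id, Pi.mul_apply]
  push_cast
  field_simp
  ring

theorem continuousOn_pohozaev (h : RadialFlow α β a u v) :
    ContinuousOn (fun r => r ^ 2 * hamiltonian α β (u r) (v r) - r * (u r * v r) / 2)
      (Set.Ici 0) := by
  have := h.cont_u
  have := h.cont_v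
  have := h.continuousOn_hamiltonian
  fun_prop

/-- The crude bound `v² ≤ 3` gives `N' ≥ -(3 / 2) α r`, integrated over `[0, 8]`. The loss is linear
in `α`, hence negligible against `β` times a large logarithm. -/
theorem pohozaev_lower (hα : 0 ≤ α) (hα1 : α ≤ 1) (hβ : 0 ≤ β) (h : RadialFlow α β 1 u v) :
    -(48 * α) ≤ 8 ^ 2 * hamiltonian α β (u 8) (v 8) - 8 * (u 8 * v 8) / 2 := by
  have hc := h.continuousOn_pohozaev.mono (fun r (hr : r ∈ Set.Icc 0 8) => hr.1)
  have := le_of_hasDerivAt_nonneg (a := 0) (b := 8)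
    (f := fun r => (r ^ 2 * hamiltonian α β (u r) (v r) - r * (u r * v r) / 2) +
      3 / 4 * α * r ^ 2)
    (f' := fun r => r / 2 * (β * u r ^ 2 - α * v r ^ 2) + 3 / 4 * α * (2 * r)) (by norm_num)
    (by fun_prop) (fun r hr => ?_) (fun r hr => ?_)
  · norm_num at this ⊢
    linarith
  · exact (h.hasDerivAt_pohozaev hr.1).add
      (((hasDerivAt_pow 2 r).congr_deriv (by simp)).const_mul (3 / 4 * α))
  · have h1 := h.normSq_le hα hβ hr.1.le
    have h2 : v r ^ 2 ≤ 3 := by linarith [sq_nonneg (u r)]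
    have h3 : α * v r ^ 2 ≤ α * 3 := by gcongr
    have h4 : 0 ≤ β * u r ^ 2 := by positivity
    have h5 : 0 ≤ r / 2 * (β * u r ^ 2 - α * v r ^ 2 + 3 * α) := by
      have := hr.1
      have : 0 ≤ β * u r ^ 2 - α * v r ^ 2 + 3 * α := by linarith
      positivity
    linarith

/-- The rescaled solution at radius `8` is close to the massless one. -/
theorem close_at_eight (hα : 0 ≤ α) (hαβ : α ≤ β) (hβ : β ≤ Real.exp (-7000))
    (h : RadialFlow α β 1 u v) : |u 8 - 4 / 17| ≤ 1 / 200 ∧ |v 8 - 1 / 17| ≤ 1 / 200 := by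
  have hβ0 : 0 ≤ β := hα.trans hαβ
  have hβ1 : β ≤ 1 := hβ.trans (Real.exp_le_one_iff.2 (by norm_num))
  have h1 := dist_sq_le (B := 3) (R := 8) radialFlow_massless h le_rfl le_rfl
    (fun r _ => by
      have : (2 * r / (4 + r ^ 2)) ^ 2 + (4 / (4 + r ^ 2)) ^ 2 = 4 / (4 + r ^ 2) := by
        field_simp; ring
      rw [this, div_le_iff₀ (by positivity)]
      nlinarith [sq_nonneg r])
    (fun r hr => (h.normSq_le hα (hα.trans hαβ) hr.1).trans (by linarith))
    (r := 8) ⟨by norm_num, le_rfl⟩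
  -- Gronwall costs only `exp 104`, so smallness is ample here; the size of `exp (-7000)` is
  -- dictated by the logarithmic estimate in `exists_v_nonpos_of_small`.
  have h2 : (3 * ((0 - α) ^ 2 + (0 - β) ^ 2) * 8) * Real.exp ((4 * 3 + 0 + 0 + 1) * 8) ≤
      (1 / 200) ^ 2 := by
    have e1 : α ^ 2 ≤ β ^ 2 := by gcongr
    have e2 : β ^ 2 ≤ Real.exp (-14000) := by
      calc β ^ 2 ≤ Real.exp (-7000) ^ 2 := by gcongr
        _ = _ := by rw [← Real.exp_nat_mul]; norm_num
    have e3 : Real.exp (-14000) * Real.exp ((4 * 3 + 0 + 0 + 1) * 8) ≤ Real.exp (-36) := by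
      rw [← Real.exp_add]
      exact Real.exp_le_exp.2 (by norm_num)
    have e4 : Real.exp (-36) ≤ 1 / 2 ^ 36 := by
      rw [Real.exp_neg, inv_eq_one_div]
      have : (2 : ℝ) ^ 36 ≤ Real.exp 36 := by
        have h3 : (2 : ℝ) ≤ Real.exp 1 := by linarith [Real.add_one_le_exp (1 : ℝ)]
        calc (2 : ℝ) ^ 36 ≤ Real.exp 1 ^ 36 := by gcongr
          _ = _ := by rw [← Real.exp_nat_mul]; norm_num
      gcongr
    have e5 : 3 * ((0 - α) ^ 2 + (0 - β) ^ 2) * 8 ≤ 48 * Real.exp (-14000) := by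
      simp only [zero_sub, neg_sq]
      linarith
    calc _ ≤ (48 * Real.exp (-14000)) * Real.exp ((4 * 3 + 0 + 0 + 1) * 8) := by gcongr
      _ = 48 * (Real.exp (-14000) * Real.exp ((4 * 3 + 0 + 0 + 1) * 8)) := by ring
      _ ≤ 48 * (1 / 2 ^ 36) := by
          gcongr
          exact e3.trans e4
      _ ≤ _ := by norm_num
  norm_num at h1 h2
  constructor
  · refine abs_le_of_sq_le_sq ?_ (by norm_num)
    linarith [sq_nonneg (1 / 17 - v 8), sq_nonneg (4 / 17 - u 8)]
  · refine abs_le_of_sq_le_sq ?_ (by norm_num)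
    linarith [sq_nonneg (1 / 17 - v 8), sq_nonneg (4 / 17 - u 8)]

section Exterior

variable {R₁ : ℝ}

/-- The weighted norm starts at no less than `3` at radius `8`, and on `[8, R₁]` the exponential
weight stays below `10 / 9` because `β R₁` is small. -/
theorem two_le_sq_mul_normSq (hα : 0 < α) (hαβ : α < β) (h : RadialFlow α β 1 u v)
    (hR : 8 < R₁) (hβR : 121 * β * R₁ ^ 2 = 1) (h8 : |u 8 - 4 / 17| ≤ 1 / 200) {r : ℝ}
    (hr : r ∈ Set.Icc 8 R₁) : 2 ≤ r ^ 2 * (u r ^ 2 + v r ^ 2) := by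
  have hβ : 0 < β := hα.trans hαβ
  have hr8 := hr.1
  have h1 := h.weighted_normSq_mono hα.le (hα.trans hαβ).le (r := 8) (s := r) (by norm_num) hr.1
  have h2 : (1 : ℝ) ≤ Real.exp ((α + β) * 8) := Real.one_le_exp (by positivity)
  have h3 : Real.exp ((α + β) * r) ≤ 10 / 9 := by
    have e1 : (α + β) * r ≤ 1 / 10 := by
      have : (α + β) * r ≤ (β + β) * R₁ := by
        have := hr.2
        gcongr
      nlinarith
    calc _ ≤ Real.exp (1 / 10) := Real.exp_le_exp.2 e1
      _ ≤ 1 / (1 - 1 / 10) := Real.exp_bound_div_one_sub_of_interval (by norm_num) (by norm_num)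
      _ = _ := by norm_num
  have h4 : 3 ≤ (8 : ℝ) ^ 2 * (u 8 ^ 2 + v 8 ^ 2) := by
    rw [abs_le] at h8
    nlinarith [sq_nonneg (v 8)]
  have h5 : 3 ≤ (8 : ℝ) ^ 2 * (u 8 ^ 2 + v 8 ^ 2) * Real.exp ((α + β) * 8) := by nlinarith
  have h6 : r ^ 2 * (u r ^ 2 + v r ^ 2) * Real.exp ((α + β) * r) ≤
      r ^ 2 * (u r ^ 2 + v r ^ 2) * (10 / 9) := by gcongr
  linarith

theorem eight_fifths_le (hα : 0 < α) (hαβ : α < β) (h : RadialFlow α β 1 u v)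
    (hR : 8 < R₁) (hβR : 121 * β * R₁ ^ 2 = 1) (h8 : |u 8 - 4 / 17| ≤ 1 / 200) {r : ℝ}
    (hr : r ∈ Set.Icc 8 R₁) (hv : 0 < v r) (huv : 2 * v r ≤ u r) :
    8 / 5 ≤ r ^ 2 * u r ^ 2 := by
  have h1 := two_le_sq_mul_normSq hα hαβ h hR hβR h8 hr
  have h2 : v r ^ 2 ≤ u r ^ 2 / 4 := by nlinarith
  have h3 : r ^ 2 * (u r ^ 2 + v r ^ 2) ≤ r ^ 2 * (u r ^ 2 + u r ^ 2 / 4) := by gcongr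
  linarith

/-- The ratio `r v / u` has derivative `(-4 N / r + r (β u² - α v²)) / u²`. While `2 v ≤ u`, `N` is
nondecreasing past `8`, so `N ≥ -48 α`; with `r² u² ≥ 8 / 5` the derivative is at most `(120 α + β)
r ≤ 121 β r`. By the choice of `R₁` the ratio grows by at most `1 / 2` from its initial bound `5 /
2`. -/
theorem mul_v_le (hα : 0 < α) (hαβ : α < β) (h : RadialFlow α β 1 u v)
    (hR : 8 < R₁) (hβR : 121 * β * R₁ ^ 2 = 1) (h8 : |u 8 - 4 / 17| ≤ 1 / 200)
    (h8' : |v 8 - 1 / 17| ≤ 1 / 200) (hv : ∀ r, 0 ≤ r → 0 < v r) {r : ℝ}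
    (hr : r ∈ Set.Icc 8 R₁) (huv : ∀ t ∈ Set.Icc 8 r, 2 * v t ≤ u t) :
    r * v r ≤ 3 * u r := by
  have hβ : 0 < β := hα.trans hαβ
  have hα1 : α ≤ 1 := by nlinarith
  have hr8 := hr.1
  have hvp : ∀ t ∈ Set.Icc 8 r, 0 < v t := fun t ht => hv t (by linarith [ht.1])
  have hup : ∀ t ∈ Set.Icc 8 r, 0 < u t := fun t ht => by linarith [huv t ht, hvp t ht]
  have hcu := h.cont_u.mono (fun t (ht : t ∈ Set.Icc 8 r) => (by
    have := ht.1
    exact Set.mem_Ici.2 (by linarith)))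
  have hcv := h.cont_v.mono (fun t (ht : t ∈ Set.Icc 8 r) => (by
    have := ht.1
    exact Set.mem_Ici.2 (by linarith)))
  have hN : ∀ t ∈ Set.Icc 8 r,
      -(48 * α) ≤ t ^ 2 * hamiltonian α β (u t) (v t) - t * (u t * v t) / 2 := by
    intro t ht
    refine (h.pohozaev_lower hα.le hα1 hβ.le).trans (le_of_hasDerivAt_nonneg ht.1
      (h.continuousOn_pohozaev.mono fun s hs => Set.mem_Ici.2 (by linarith [hs.1]))
      (fun s hs => h.hasDerivAt_pohozaev (by linarith [hs.1])) fun s hs => ?_)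
    have hs' : s ∈ Set.Icc 8 r := ⟨hs.1.le, hs.2.le.trans ht.2⟩
    have h1 := huv s hs'
    have h2 := hvp s hs'
    have h3 : α * v s ^ 2 ≤ β * u s ^ 2 := by
      have : v s ≤ u s := by linarith
      gcongr
    have : 0 < s := by linarith [hs.1]
    have : 0 ≤ β * u s ^ 2 - α * v s ^ 2 := by linarith
    positivity
  have key := le_of_hasDerivAt_nonpos (f := fun t => t * v t / u t - 121 * β * t ^ 2 / 2)
    (f' := fun t => (-4 * (t ^ 2 * hamiltonian α β (u t) (v t) - t * (u t * v t) / 2) / t +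
      t * (β * u t ^ 2 - α * v t ^ 2)) / u t ^ 2 - 121 * β * t) hr.1
    (by
      have : ∀ t ∈ Set.Icc 8 r, u t ≠ 0 := fun t ht => (hup t ht).ne'
      fun_prop (disch := assumption)) (fun t ht => ?_) (fun t ht => ?_)
  · have hu8 := hup 8 ⟨le_rfl, hr.1⟩
    have hur := hup r ⟨hr.1, le_rfl⟩
    have e1 : 8 * v 8 / u 8 ≤ 5 / 2 := by
      rw [div_le_iff₀ hu8]
      rw [abs_le] at h8 h8'
      linarith
    have e2 : 121 * β * r ^ 2 ≤ 1 := by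
      rw [← hβR]
      have := hr.2
      gcongr
    have e3 : 0 ≤ 121 * β * (8 : ℝ) ^ 2 / 2 := by positivity
    have e4 : r * v r / u r ≤ 3 := by linarith
    rwa [div_le_iff₀ hur] at e4
  · have ht' : t ∈ Set.Icc 8 r := ⟨ht.1.le, ht.2.le⟩
    have ht0 : 0 < t := by linarith [ht.1]
    have hu := hup t ht'
    refine ((((hasDerivAt_id t).mul (h.hasDeriv_v t ht0)).div (h.hasDeriv_u t ht0) hu.ne').sub
      (((hasDerivAt_pow 2 t).const_mul (121 * β)).div_const 2)).congr_deriv ?_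
    simp only [hamiltonian, id, Pi.mul_apply]
    push_cast
    field_simp
    ring
  · have ht' : t ∈ Set.Icc 8 r := ⟨ht.1.le, ht.2.le⟩
    have ht0 : 0 < t := by linarith [ht.1]
    have hu := hup t ht'
    have h1 := hN t ht'
    have h2 := eight_fifths_le hα hαβ h hR hβR h8 ⟨ht'.1, ht'.2.trans hr.2⟩ (hvp t ht') (huv t ht')
    generalize t ^ 2 * hamiltonian α β (u t) (v t) - t * (u t * v t) / 2 = N at h1
    have e1 : -4 * N / t ≤ 192 * α / t := by
      refine div_le_div_of_nonneg_right ?_ ht0.le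
      linarith
    have e2 : 192 * α / t ≤ 120 * α * t * u t ^ 2 := by
      rw [div_le_iff₀ ht0]
      nlinarith
    have e3 : 0 ≤ α * v t ^ 2 := by positivity
    have e4 : (-4 * N / t + t * (β * u t ^ 2 - α * v t ^ 2)) / u t ^ 2 ≤ 121 * β * t := by
      rw [div_le_iff₀ (by positivity)]
      have e5 : 0 ≤ t * (α * v t ^ 2) := by positivity
      have e6 : α * (t * u t ^ 2) ≤ β * (t * u t ^ 2) := by gcongr
      linarith
    linarith

/-- A bootstrap: under the hypothesis on `[8, r]`, `mul_v_le` returns `v ≤ (3 / r) u`, which is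
strictly better than `u / 2` since `3 / 8 < 1 / 2`. -/
theorem two_mul_v_le (hα : 0 < α) (hαβ : α < β) (h : RadialFlow α β 1 u v)
    (hR : 8 < R₁) (hβR : 121 * β * R₁ ^ 2 = 1) (h8 : |u 8 - 4 / 17| ≤ 1 / 200)
    (h8' : |v 8 - 1 / 17| ≤ 1 / 200) (hv : ∀ r, 0 ≤ r → 0 < v r) {r : ℝ}
    (hr : r ∈ Set.Icc 8 R₁) : 2 * v r ≤ u r := by
  have hsub : Set.Icc 8 R₁ ⊆ Set.Ici 0 := fun t ht => Set.mem_Ici.2 (by linarith [ht.1])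
  have hcu := h.cont_u.mono hsub
  have hcv := h.cont_v.mono hsub
  have := pos_on_Icc_of_nonneg_propagates (f := fun t => u t - 2 * v t) (by fun_prop)
    (by rw [abs_le] at h8 h8'; linarith) (fun t ht hpos => by
      have h1 := mul_v_le hα hαβ h hR hβR h8 h8' hv ⟨ht.1.le, ht.2⟩
        fun s hs => by linarith [hpos s hs]
      have h2 := hv t (by linarith [ht.1])
      nlinarith [ht.1]) r hr
  linarith

/-- Since `r v ≤ 3 u`, the derivative of `r² (u² + v²)` is at most `18 u² / r`; the relative growth
rate `18 / r³` is integrable and is compensated by `exp (9 / r²)`. -/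
theorem sq_mul_normSq_le (hα : 0 < α) (hαβ : α < β) (h : RadialFlow α β 1 u v)
    (hR : 8 < R₁) (hβR : 121 * β * R₁ ^ 2 = 1) (h8 : |u 8 - 4 / 17| ≤ 1 / 200)
    (h8' : |v 8 - 1 / 17| ≤ 1 / 200) (hv : ∀ r, 0 ≤ r → 0 < v r) :
    R₁ ^ 2 * (u R₁ ^ 2 + v R₁ ^ 2) ≤ 8 := by
  have hβ : 0 < β := hα.trans hαβ
  have hsub : Set.Icc 8 R₁ ⊆ Set.Ici 0 := fun t ht => Set.mem_Ici.2 (by linarith [ht.1])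
  have hcu := h.cont_u.mono hsub
  have hcv := h.cont_v.mono hsub
  have hne : ∀ t ∈ Set.Icc 8 R₁, t ^ 2 ≠ 0 := fun t ht => by
    have : 0 < t := by linarith [ht.1]
    positivity
  have key := le_of_hasDerivAt_nonpos
    (f := fun t => t ^ 2 * (u t ^ 2 + v t ^ 2) * Real.exp (9 / t ^ 2))
    (f' := fun t => (2 * t * v t ^ 2 - 2 * (α + β) * t ^ 2 * (u t * v t) -
      18 / t * (u t ^ 2 + v t ^ 2)) * Real.exp (9 / t ^ 2)) hR.le
    (by fun_prop (disch := assumption)) (fun t ht => ?_) (fun t ht => ?_)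
  · have e1 : Real.exp (9 / 8 ^ 2) ≤ 2 := by
      calc Real.exp (9 / 8 ^ 2) ≤ 1 / (1 - 9 / 8 ^ 2) :=
            Real.exp_bound_div_one_sub_of_interval (by norm_num) (by norm_num)
        _ ≤ _ := by norm_num
    have e2 : 1 ≤ Real.exp (9 / R₁ ^ 2) := Real.one_le_exp (by positivity)
    have e3 : (8 : ℝ) ^ 2 * (u 8 ^ 2 + v 8 ^ 2) ≤ 4 := by
      rw [abs_le] at h8 h8'
      nlinarith
    calc _ ≤ R₁ ^ 2 * (u R₁ ^ 2 + v R₁ ^ 2) * Real.exp (9 / R₁ ^ 2) :=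
          le_mul_of_one_le_right (by positivity) e2
      _ ≤ _ := key
      _ ≤ 4 * 2 := by gcongr
      _ = _ := by norm_num
  · have ht0 : 0 < t := by linarith [ht.1]
    refine (((hasDerivAt_pow 2 t).mul (h.hasDerivAt_normSq ht0)).mul
      (((hasDerivAt_const t 9).div (hasDerivAt_pow 2 t) (by positivity)).exp)).congr_deriv ?_
    simp only [Pi.mul_apply, Pi.div_apply]
    push_cast
    field_simp
    ring
  · have ht0 : 0 < t := by linarith [ht.1]
    have ht' : t ∈ Set.Icc 8 R₁ := ⟨ht.1.le, ht.2.le⟩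
    have hv0 := hv t ht0.le
    have hu0 : 0 < u t := by linarith [two_mul_v_le hα hαβ h hR hβR h8 h8' hv ht']
    have h1 := mul_v_le hα hαβ h hR hβR h8 h8' hv ht' fun s hs =>
      two_mul_v_le hα hαβ h hR hβR h8 h8' hv ⟨hs.1, hs.2.trans ht'.2⟩
    have h2 : (t * v t) ^ 2 ≤ (3 * u t) ^ 2 := by gcongr
    have h3 : 2 * t * v t ^ 2 ≤ 18 / t * u t ^ 2 := by
      rw [div_mul_eq_mul_div, le_div_iff₀ ht0]
      linarith
    have h4 : 0 ≤ 2 * (α + β) * t ^ 2 * (u t * v t) := by positivity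
    have h5 : 0 ≤ 18 / t * v t ^ 2 := by positivity
    refine mul_nonpos_of_nonpos_of_nonneg ?_ (Real.exp_pos _).le
    linarith

/-- From `v ≤ u / 2` and `r² u² ≥ 8 / 5` one gets `N' ≥ (3 / 5) β / r`. Comparing `N(R₁) ≤ 1940 β`
with `N(8) ≥ -48 β` leaves `(5 / 3) · 1988 < 3314` for the logarithm. -/
theorem log_le_of_v_pos (hα : 0 < α) (hαβ : α < β) (h : RadialFlow α β 1 u v)
    (hR : 8 < R₁) (hβR : 121 * β * R₁ ^ 2 = 1) (h8 : |u 8 - 4 / 17| ≤ 1 / 200)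
    (h8' : |v 8 - 1 / 17| ≤ 1 / 200) (hv : ∀ r, 0 ≤ r → 0 < v r) :
    Real.log R₁ - Real.log 8 ≤ 3314 := by
  have hβ : 0 < β := hα.trans hαβ
  have hα1 : α ≤ 1 := by nlinarith
  have hsub : Set.Icc 8 R₁ ⊆ Set.Ici 0 := fun t ht => Set.mem_Ici.2 (by linarith [ht.1])
  have hcN := h.continuousOn_pohozaev.mono hsub
  have hne : ∀ t ∈ Set.Icc 8 R₁, t ≠ 0 := fun t ht => by
    have : 0 < t := by linarith [ht.1]
    positivity
  have key := le_of_hasDerivAt_nonneg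
    (f := fun t => (t ^ 2 * hamiltonian α β (u t) (v t) - t * (u t * v t) / 2) -
      3 / 5 * β * Real.log t)
    (f' := fun t => t / 2 * (β * u t ^ 2 - α * v t ^ 2) - 3 / 5 * β * t⁻¹) hR.le
    (by fun_prop (disch := assumption)) (fun t ht => ?_) (fun t ht => ?_)
  · have h1 := h.pohozaev_lower hα.le hα1 hβ.le
    have h2 := sq_mul_normSq_le hα hαβ h hR hβR h8 h8' hv
    have hv0 := hv R₁ (by linarith)
    have hu0 : 0 < u R₁ := by
      linarith [two_mul_v_le hα hαβ h hR hβR h8 h8' hv ⟨hR.le, le_rfl⟩]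
    have hR0 : 0 < R₁ := by linarith
    -- `121 β R₁² = 1` turns the quartic term into `8 · 8 · 121 β / 4 = 1936 β`; the quadratic term
    -- adds `4 β`.
    have h3 : R₁ ^ 2 * hamiltonian α β (u R₁) (v R₁) - R₁ * (u R₁ * v R₁) / 2 ≤ 1940 * β := by
      have e0 : 0 ≤ R₁ ^ 2 * (u R₁ ^ 2 + v R₁ ^ 2) := by positivity
      have e1 : R₁ ^ 2 * (u R₁ ^ 2 + v R₁ ^ 2) ^ 2 ≤ 8 * (8 * (121 * β)) := by
        have d1 : u R₁ ^ 2 + v R₁ ^ 2 = 121 * β * (R₁ ^ 2 * (u R₁ ^ 2 + v R₁ ^ 2)) := by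
          rw [← mul_assoc, hβR, one_mul]
        have d2 : u R₁ ^ 2 + v R₁ ^ 2 ≤ 8 * (121 * β) := by
          rw [d1]
          nlinarith
        rw [sq (u R₁ ^ 2 + v R₁ ^ 2), ← mul_assoc]
        gcongr
      have e2 : R₁ ^ 2 * u R₁ ^ 2 ≤ 8 := by
        have : 0 ≤ R₁ ^ 2 * v R₁ ^ 2 := by positivity
        linarith
      have e3 : β * (R₁ ^ 2 * u R₁ ^ 2) ≤ β * 8 := by gcongr
      have e4 : 0 ≤ R₁ ^ 2 * (α * v R₁ ^ 2) := by positivity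
      have e5 : 0 ≤ R₁ * (u R₁ * v R₁) := by positivity
      unfold hamiltonian
      linarith
    have h4 : 3 / 5 * β * (Real.log R₁ - Real.log 8) ≤ 1988 * β := by linarith
    nlinarith
  · have ht0 : 0 < t := by linarith [ht.1]
    exact (h.hasDerivAt_pohozaev ht0).sub ((Real.hasDerivAt_log ht0.ne').const_mul _)
  · have ht0 : 0 < t := by linarith [ht.1]
    have ht' : t ∈ Set.Icc 8 R₁ := ⟨ht.1.le, ht.2.le⟩
    have hv0 := hv t ht0.le
    have h1 := two_mul_v_le hα hαβ h hR hβR h8 h8' hv ht'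
    have h2 := eight_fifths_le hα hαβ h hR hβR h8 ht' hv0 h1
    have h3 : α * v t ^ 2 ≤ β * (u t ^ 2 / 4) := by
      have : v t ^ 2 ≤ u t ^ 2 / 4 := by nlinarith
      gcongr
    have h4 : 3 / 5 * β * t⁻¹ ≤ t / 2 * (β * (3 / 4 * u t ^ 2)) := by
      rw [← div_eq_mul_inv, div_le_iff₀ ht0]
      nlinarith
    have h5 : t / 2 * (β * (3 / 4 * u t ^ 2)) ≤ t / 2 * (β * u t ^ 2 - α * v t ^ 2) := by
      gcongr
      linarith
    linarith

end Exterior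

/-- For small masses the rescaled solution changes sign. -/
theorem exists_v_nonpos_of_small (hα : 0 < α) (hαβ : α < β) (hβ : β ≤ Real.exp (-7000))
    (h : RadialFlow α β 1 u v) : ∃ r, 0 ≤ r ∧ v r ≤ 0 := by
  by_contra! hv
  have hβ0 : 0 < β := hα.trans hαβ
  obtain ⟨h8, h8'⟩ := h.close_at_eight hα.le hαβ.le hβ
  have hpos : 0 < 121 * β := by positivity
  have hlog : 7000 - 120 ≤ -Real.log (121 * β) := by
    rw [Real.log_mul (by norm_num) hβ0.ne']
    have h1 : Real.log β ≤ -7000 := by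
      rw [← Real.log_exp (-7000)]
      exact Real.log_le_log hβ0 hβ
    have h2 := Real.log_le_sub_one_of_pos (show (0 : ℝ) < 121 by norm_num)
    linarith
  have hlog8 := Real.log_le_sub_one_of_pos (show (0 : ℝ) < 8 by norm_num)
  have hR : Real.log (1 / √(121 * β)) = -Real.log (121 * β) / 2 := by
    rw [one_div, Real.log_inv, Real.log_sqrt hpos.le]
    ring
  have hR8 : 8 < 1 / √(121 * β) := by
    rw [← Real.log_lt_log_iff (by norm_num) (by positivity), hR]
    linarith
  have := log_le_of_v_pos hα hαβ h hR8 (by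
    rw [div_pow, Real.sq_sqrt hpos.le]
    field_simp) h8 h8' hv
  rw [hR] at this
  linarith

/-- Large shooting data lead to a sign change. -/
theorem sq_le_of_v_pos (hα : 0 < α) (hαβ : α < β) (ha : 0 < a) (h : RadialFlow α β a u v)
    (hv : ∀ r, 0 ≤ r → 0 < v r) : a ^ 2 ≤ β / Real.exp (-7000) := by
  by_contra! hc
  have hE := Real.exp_pos (-7000)
  obtain ⟨r, hr, hvr⟩ := (h.rescale ha).exists_v_nonpos_of_small (by positivity)
    (by gcongr) (by
      rw [div_lt_iff₀ hE] at hc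
      rw [div_le_iff₀ (by positivity)]
      linarith)
  have h1 := hv (r / a ^ 2) (by positivity)
  have h2 : 0 < v (r / a ^ 2) / a := by positivity
  linarith

end RadialFlow

/-! ### Openness, limits and decay at nonnegative energy -/

theorem exists_tendsto_of_antitone {f : ℝ → ℝ} {b : ℝ}
    (hf : ∀ r s, 0 ≤ r → r ≤ s → f s ≤ f r) (hb : ∀ r, 0 ≤ r → b ≤ f r) :
    ∃ L, Tendsto f atTop (𝓝 L) ∧ b ≤ L ∧ ∀ r, 0 ≤ r → L ≤ f r := by
  have hanti : Antitone fun r => f (max r 0) := fun r s hrs =>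
    hf _ _ (le_max_right _ _) (max_le_max_right 0 hrs)
  have hbdd : BddBelow (Set.range fun r => f (max r 0)) :=
    ⟨b, by rintro _ ⟨r, rfl⟩; exact hb _ (le_max_right _ _)⟩
  refine ⟨⨅ r, f (max r 0), (tendsto_atTop_ciInf hanti hbdd).congr' ?_,
    le_ciInf fun r => hb _ (le_max_right _ _), fun r hr => ?_⟩
  · filter_upwards [eventually_ge_atTop 0] with r hr
    rw [max_eq_left hr]
  · simpa [max_eq_left hr] using ciInf_le hbdd r

/-- If a function and its derivative both converge at infinity, the derivative tends to `0`. -/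
theorem eq_zero_of_tendsto_of_tendsto_deriv {f f' : ℝ → ℝ} {c d : ℝ}
    (hd : ∀ r, 0 < r → HasDerivAt f (f' r) r) (hf : Tendsto f atTop (𝓝 c))
    (hf' : Tendsto f' atTop (𝓝 d)) : d = 0 := by
  have hex : ∀ r : ℝ, ∃ ξ, r ≤ ξ ∧ (0 < r → f' ξ = f (r + 1) - f r) := by
    intro r
    rcases lt_or_ge 0 r with hr | hr
    · obtain ⟨ξ, hξ, h⟩ := exists_hasDerivAt_eq_slope f f' (show r < r + 1 by linarith)
        (fun t ht => (hd t (hr.trans_le ht.1)).continuousAt.continuousWithinAt)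
        (fun t ht => hd t (hr.trans ht.1))
      exact ⟨ξ, hξ.1.le, fun _ => by rw [h]; simp⟩
    · exact ⟨r, le_rfl, fun h => absurd h (not_lt.2 hr)⟩
  choose ξ hξ hslope using hex
  have h1 : Tendsto (fun r => f' (ξ r)) atTop (𝓝 d) :=
    hf'.comp (tendsto_atTop_mono hξ tendsto_id)
  have h2 : Tendsto (fun r => f (r + 1) - f r) atTop (𝓝 (c - c)) :=
    (hf.comp (tendsto_atTop_add_const_right _ 1 tendsto_id)).sub hf
  rw [sub_self] at h2
  refine tendsto_nhds_unique (h1.congr' ?_) h2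
  filter_upwards [eventually_gt_atTop 0] with r hr
  exact hslope r hr

theorem hamiltonian_ge {α β : ℝ} (hβ : 0 ≤ β) (x y : ℝ) :
    -(α ^ 2 / 4) ≤ hamiltonian α β x y := by
  unfold hamiltonian
  have h1 : 0 ≤ x ^ 2 * (x ^ 2 + 2 * y ^ 2 + 2 * β) := by positivity
  linarith [sq_nonneg (y ^ 2 - α)]

namespace RadialFlow

variable {α β a : ℝ} {u v : ℝ → ℝ}

/-- On `v = 0` the energy is `u⁴ / 4 + β u² / 2 ≥ 0`, so a trajectory of negative energy cannot
reach that line. -/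
theorem v_pos_of_hamiltonian_neg (hβ : 0 ≤ β) (h : RadialFlow α β a u v) {R : ℝ} (hR : 0 ≤ R)
    (hvR : 0 < v R) (hH : hamiltonian α β (u R) (v R) < 0) {r : ℝ} (hr : R ≤ r) : 0 < v r := by
  refine pos_on_Icc_of_nonneg_propagates
    (h.cont_v.mono fun t (ht : t ∈ Set.Icc R r) => hR.trans ht.1) hvR (fun t ht hpos => ?_)
    r ⟨hr, le_rfl⟩
  refine (hpos t ⟨ht.1.le, le_rfl⟩).lt_of_ne' fun h0 => ?_
  have h1 := h.hamiltonian_antitone hβ hR ht.1.le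
  have h2 : 0 ≤ hamiltonian α β (u t) (v t) := by
    rw [h0, hamiltonian]
    have : 0 ≤ β * u t ^ 2 := by positivity
    nlinarith [sq_nonneg (u t ^ 2)]
  linarith

theorem unique {u' v' : ℝ → ℝ} (hα : 0 ≤ α) (hβ : 0 ≤ β) (h : RadialFlow α β a u v)
    (h' : RadialFlow α β a u' v') {r : ℝ} (hr : 0 ≤ r) : u r = u' r ∧ v r = v' r := by
  have := h.dist_sq_le h' hα hβ (fun t ht => h.normSq_le hα hβ ht.1)
    (fun t ht => h'.normSq_le hα hβ ht.1) (r := r) ⟨hr, le_rfl⟩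
  simp only [sub_self] at this
  norm_num at this
  constructor <;> nlinarith [sq_nonneg (u r - u' r), sq_nonneg (v r - v' r)]

/-- Locally uniform continuity of the flow in the shooting parameter. -/
theorem eventually_close {uf vf : ℝ → ℝ → ℝ} (hα : 0 ≤ α) (hβ : 0 ≤ β)
    (hf : ∀ a, RadialFlow α β a (uf a) (vf a)) (a₀ R : ℝ) {c : ℝ} (hc : 0 < c) :
    ∀ᶠ a in 𝓝 a₀, ∀ r ∈ Set.Icc 0 R,
      |uf a r - uf a₀ r| < c ∧ |vf a r - vf a₀ r| < c := by
  set B := (|a₀| + 1) ^ 2 + 2 * α with hB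
  set K := 4 * B + α + β + 1 with hK
  have hlim : Tendsto (fun a => (a - a₀) ^ 2 * Real.exp (K * R)) (𝓝 a₀) (𝓝 0) := by
    have : Continuous fun a => (a - a₀) ^ 2 * Real.exp (K * R) := by fun_prop
    simpa using this.tendsto a₀
  filter_upwards [hlim.eventually (gt_mem_nhds (show 0 < c ^ 2 by positivity)),
    Metric.ball_mem_nhds a₀ one_pos] with a ha1 ha2 r hr
  rw [Metric.mem_ball, Real.dist_eq] at ha2
  have hb : ∀ b, |b| ≤ |a₀| + 1 → ∀ t ∈ Set.Icc 0 R, uf b t ^ 2 + vf b t ^ 2 ≤ B := by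
    intro b hb t ht
    refine ((hf b).normSq_le hα hβ ht.1).trans ?_
    rw [hB, ← sq_abs b]
    gcongr
  have h1 := (hf a).dist_sq_le (hf a₀) hα hβ
    (hb a (by linarith [abs_sub_abs_le_abs_sub a a₀])) (hb a₀ (by linarith)) hr
  have h2 : ((a - a₀) ^ 2 + B * ((α - α) ^ 2 + (β - β) ^ 2) * r) * Real.exp (K * r) ≤
      (a - a₀) ^ 2 * Real.exp (K * R) := by
    simp only [sub_self]
    norm_num
    have := hr.2
    gcongr
  constructor <;> refine abs_lt_of_sq_lt_sq ?_ hc.le <;>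
    linarith [sq_nonneg (uf a r - uf a₀ r), sq_nonneg (vf a r - vf a₀ r)]

/-- The set of data with positive `v` and eventually negative energy is open. -/
theorem eventually_pos_and_neg {uf vf : ℝ → ℝ → ℝ} (hα : 0 ≤ α) (hβ : 0 ≤ β)
    (hf : ∀ a, RadialFlow α β a (uf a) (vf a)) {a₀ R : ℝ} (hR : 0 ≤ R)
    (hv : ∀ r, 0 ≤ r → 0 < vf a₀ r) (hH : hamiltonian α β (uf a₀ R) (vf a₀ R) < 0) :
    ∀ᶠ a in 𝓝 a₀, (∀ r, 0 ≤ r → 0 < vf a r) ∧ hamiltonian α β (uf a R) (vf a R) < 0 := by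
  -- Up to `R` positivity survives perturbations smaller than the minimum of `v`; beyond `R`
  -- negative energy takes over.
  obtain ⟨x, hx, hmin⟩ := isCompact_Icc.exists_isMinOn (Set.nonempty_Icc.2 hR)
    ((hf a₀).cont_v.mono fun t (ht : t ∈ Set.Icc 0 R) => ht.1)
  have hRmem : R ∈ Set.Icc 0 R := ⟨hR, le_rfl⟩
  have htu : Tendsto (fun a => uf a R) (𝓝 a₀) (𝓝 (uf a₀ R)) :=
    Metric.tendsto_nhds.2 fun c hc => by
      filter_upwards [eventually_close hα hβ hf a₀ R hc] with a ha
      exact (ha R hRmem).1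
  have htv : Tendsto (fun a => vf a R) (𝓝 a₀) (𝓝 (vf a₀ R)) :=
    Metric.tendsto_nhds.2 fun c hc => by
      filter_upwards [eventually_close hα hβ hf a₀ R hc] with a ha
      exact (ha R hRmem).2
  have htH : Tendsto (fun a => hamiltonian α β (uf a R) (vf a R)) (𝓝 a₀)
      (𝓝 (hamiltonian α β (uf a₀ R) (vf a₀ R))) := by
    unfold hamiltonian
    exact ((((htu.pow 2).add (htv.pow 2)).pow 2).div_const 4).add
      ((((htu.pow 2).const_mul β).sub ((htv.pow 2).const_mul α)).div_const 2)
  filter_upwards [eventually_close hα hβ hf a₀ R (hv x hx.1), htH.eventually (gt_mem_nhds hH)]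
    with a ha hHa
  have hpos : ∀ r ∈ Set.Icc 0 R, 0 < vf a r := fun r hr => by
    have h1 := (abs_lt.1 (ha r hr).2).1
    have h2 : vf a₀ x ≤ vf a₀ r := hmin hr
    linarith
  refine ⟨fun r hr => ?_, hHa⟩
  rcases le_total r R with hrR | hrR
  · exact hpos r ⟨hr, hrR⟩
  · exact (hf a).v_pos_of_hamiltonian_neg hβ hR (hpos R hRmem) hHa hrR

theorem two_mul_le_sq_of_u_eq_zero
    (hH : ∀ r, 0 ≤ r → 0 ≤ hamiltonian α β (u r) (v r)) {r : ℝ} (hr : 0 ≤ r) (hvr : 0 < v r) (hur : u r = 0) :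
    2 * α ≤ v r ^ 2 := by
  have := hH r hr
  rw [hur, hamiltonian] at this
  by_contra! hc
  have : 0 < v r ^ 2 := by positivity
  nlinarith

/-- At a zero of `u`, nonnegative energy forces `v² ≥ 2α`, hence `u' > 0` there: `u` cannot come
down to zero. Near the origin the same bound makes `r u` increasing. -/
theorem u_pos (hα : 0 < α) (h : RadialFlow α β a u v) (hv : ∀ r, 0 ≤ r → 0 < v r)
    (hH : ∀ r, 0 ≤ r → 0 ≤ hamiltonian α β (u r) (v r)) {r : ℝ} (hr : 0 < r) : 0 < u r := by
  have h0 := two_mul_le_sq_of_u_eq_zero hH le_rfl (hv 0 le_rfl) h.u_zero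
  have hev : ∀ᶠ t in 𝓝[≥] (0 : ℝ), α < v t ^ 2 :=
    ((h.cont_v 0 Set.self_mem_Ici).pow 2).eventually (lt_mem_nhds (by
      rw [Pi.pow_apply]
      linarith))
  obtain ⟨δ, hδ0, hδ⟩ := (mem_nhdsGE_iff_exists_Icc_subset).1 hev
  have hδ0 : 0 < δ := hδ0
  have hinit : ∀ t, 0 < t → t ≤ δ → 0 < u t := by
    intro t ht htδ
    obtain ⟨ξ, hξ, hslope⟩ := exists_hasDerivAt_eq_slope (fun r => r * u r)
      (fun r => r * ((u r ^ 2 + v r ^ 2 - α) * v r)) ht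
      (continuousOn_id.mul (h.cont_u.mono fun s hs => hs.1)) (fun s hs => by
        refine ((hasDerivAt_id s).mul (h.hasDeriv_u s hs.1)).congr_deriv ?_
        have := hs.1
        simp only [id]
        field_simp
        ring)
    have h1 : α < v ξ ^ 2 := hδ ⟨hξ.1.le, hξ.2.le.trans htδ⟩
    have h2 : 0 < ξ * ((u ξ ^ 2 + v ξ ^ 2 - α) * v ξ) := by
      have := hv ξ hξ.1.le
      have : 0 < u ξ ^ 2 + v ξ ^ 2 - α := by linarith [sq_nonneg (u ξ)]
      have := hξ.1
      positivity
    rw [hslope] at h2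
    simp only [zero_mul, sub_zero] at h2
    rw [mul_div_cancel_left₀ _ ht.ne'] at h2
    exact h2
  rcases le_total r δ with hrδ | hrδ
  · exact hinit r hr hrδ
  refine pos_on_Icc_of_nonneg_propagates
    (h.cont_u.mono fun t (ht : t ∈ Set.Icc δ r) => hδ0.le.trans ht.1) (hinit δ hδ0 le_rfl)
    (fun t ht hpos => ?_) r ⟨hrδ, le_rfl⟩
  have ht0 : 0 < t := hδ0.trans ht.1
  refine (hpos t ⟨ht.1.le, le_rfl⟩).lt_of_ne' fun hut => ?_
  have h1 := two_mul_le_sq_of_u_eq_zero hH ht0.le (hv t ht0.le) hut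
  have h2 : 0 < (u t ^ 2 + v t ^ 2 - α) * v t - u t / t := by
    rw [hut]
    have := hv t ht0.le
    have : 0 < v t ^ 2 - α := by linarith
    norm_num
    positivity
  have h3 := (hasDerivWithinAt_iff_tendsto_slope' Set.self_notMem_Iio).1
    (h.hasDeriv_u t ht0).hasDerivWithinAt
  have h4 : (u t ^ 2 + v t ^ 2 - α) * v t - u t / t ≤ 0 := by
    refine le_of_tendsto h3 ?_
    filter_upwards [Ico_mem_nhdsLT ht.1] with s hs
    rw [slope_def_field, hut, sub_zero]
    exact div_nonpos_of_nonneg_of_nonpos (hpos s ⟨hs.1, hs.2.le⟩) (by linarith [hs.2])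
  linarith

theorem tendsto_zero (hα : 0 < α) (hβ : 0 ≤ β) (h : RadialFlow α β a u v)
    (hv : ∀ r, 0 ≤ r → 0 < v r)
    (hH : ∀ r, 0 ≤ r → 0 ≤ hamiltonian α β (u r) (v r)) :
    Tendsto u atTop (𝓝 0) ∧ Tendsto v atTop (𝓝 0) := by
  have hu : ∀ r, 0 < r → 0 < u r := fun r hr => h.u_pos hα hv hH hr
  obtain ⟨l, hvl, hl0, -⟩ := exists_tendsto_of_antitone (f := v) (b := 0) (fun r s hr hrs =>
    le_of_hasDerivAt_nonpos hrs (h.cont_v.mono fun t ht => hr.trans ht.1)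
      (fun t ht => h.hasDeriv_v t (hr.trans_lt ht.1)) fun t ht => by
        have := hu t (hr.trans_lt ht.1)
        have : 0 ≤ (u t ^ 2 + v t ^ 2 + β) * u t := by positivity
        linarith) (fun r hr => (hv r hr).le)
  obtain ⟨L, hHL, hL0, -⟩ := exists_tendsto_of_antitone (b := 0)
    (f := fun r => hamiltonian α β (u r) (v r))
    (fun r s hr hrs => h.hamiltonian_antitone hβ hr hrs) hH
  obtain ⟨k, huk⟩ : ∃ k, Tendsto u atTop (𝓝 k) := by
    -- Completing the square in `u²` recovers `u` as a continuous function of the convergent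
    -- quantities `H` and `v`.
    refine ⟨_, Tendsto.congr' ?_ (((((hHL.const_mul 4).add ((hvl.pow 2).const_mul (2 * α))).add
      (((hvl.pow 2).add_const β).pow 2)).sub ((hvl.pow 2).pow 2)).sqrt.sub
      ((hvl.pow 2).add_const β)).sqrt⟩
    filter_upwards [eventually_gt_atTop 0] with r hr
    have e1 : 4 * hamiltonian α β (u r) (v r) + 2 * α * v r ^ 2 + (v r ^ 2 + β) ^ 2 -
        (v r ^ 2) ^ 2 = (u r ^ 2 + (v r ^ 2 + β)) ^ 2 := by
      unfold hamiltonian; ring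
    rw [e1, Real.sqrt_sq (by positivity), add_sub_cancel_right, Real.sqrt_sq (hu r hr).le]
  have hk0 : 0 ≤ k := ge_of_tendsto huk (by
    filter_upwards [eventually_gt_atTop 0] with r hr using (hu r hr).le)
  have hsq := (huk.pow 2).add (hvl.pow 2)
  have hk : k = 0 := by
    have h1 := eq_zero_of_tendsto_of_tendsto_deriv h.hasDeriv_v hvl
      ((hsq.add_const β).neg.mul huk)
    rcases mul_eq_zero.1 h1 with h2 | h2
    · nlinarith [sq_nonneg k, sq_nonneg l]
    · exact h2
  subst hk
  have hl : ((0 : ℝ) ^ 2 + l ^ 2 - α) * l - 0 = 0 :=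
    eq_zero_of_tendsto_of_tendsto_deriv h.hasDeriv_u huk
      (((hsq.sub_const α).mul hvl).sub (huk.div_atTop tendsto_id))
  have hL : L = (0 ^ 2 + l ^ 2) ^ 2 / 4 + (β * 0 ^ 2 - α * l ^ 2) / 2 :=
    tendsto_nhds_unique hHL ((hsq.pow 2).div_const 4 |>.add
      ((((huk.pow 2).const_mul β).sub ((hvl.pow 2).const_mul α)).div_const 2))
  refine ⟨huk, ?_⟩
  suffices l = 0 by rwa [this] at hvl
  by_contra hne
  have h1 : l ^ 2 = α := by
    rcases mul_eq_zero.1 (by linarith : (l ^ 2 - α) * l = 0) with h2 | h2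
    · linarith
    · exact absurd h2 hne
  -- The other rest point `(0, ±√α)` has energy `-α² / 4 < 0`.
  rw [hL, h1] at hL0
  nlinarith

/-- Exponential decay of the ground state. -/
theorem exists_normSq_le_exp (hα : 0 < α) (hαβ : α ≤ β) (h : RadialFlow α β a u v)
    (hv : ∀ r, 0 ≤ r → 0 < v r)
    (hH : ∀ r, 0 ≤ r → 0 ≤ hamiltonian α β (u r) (v r)) :
    ∃ C, 0 < C ∧ ∀ r, 0 ≤ r → u r ^ 2 + v r ^ 2 ≤ C * Real.exp (-(α * r)) := by
  have hu : ∀ r, 0 < r → 0 < u r := fun r hr => h.u_pos hα hv hH hr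
  have hβ : 0 ≤ β := hα.le.trans hαβ
  obtain ⟨hu0, hv0⟩ := h.tendsto_zero hα hβ hv hH
  have hsq : Tendsto (fun r => u r ^ 2 + v r ^ 2) atTop (𝓝 0) := by
    simpa using (hu0.pow 2).add (hv0.pow 2)
  obtain ⟨R, hR⟩ := eventually_atTop.1 ((hsq.eventually
    (gt_mem_nhds (show 0 < α / 2 by positivity))).and (eventually_gt_atTop 0))
  have hR0 : 0 < R := (hR R le_rfl).2
  have hanti : ∀ r s, 0 ≤ r → r ≤ s → u s ^ 2 + v s ^ 2 ≤ u r ^ 2 + v r ^ 2 := by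
    intro r s hr hrs
    have hcu := h.cont_u.mono (fun t (ht : t ∈ Set.Icc r s) => hr.trans ht.1)
    have hcv := h.cont_v.mono (fun t (ht : t ∈ Set.Icc r s) => hr.trans ht.1)
    refine le_of_hasDerivAt_nonpos (f := fun r => u r ^ 2 + v r ^ 2) hrs (by fun_prop)
      (fun t ht => h.hasDerivAt_normSq (hr.trans_lt ht.1)) fun t ht => ?_
    have ht0 := hr.trans_lt ht.1
    have h1 := hu t ht0
    have h2 := hv t ht0.le
    have h3 : 0 ≤ 2 * u t ^ 2 / t := by positivity
    have h4 : 0 ≤ 2 * (α + β) * (u t * v t) := by positivity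
    have h5 : -2 * u t ^ 2 / t = -(2 * u t ^ 2 / t) := by ring
    linarith
  have hprod : ∀ r, 0 < r → HasDerivAt (fun r => u r * v r)
      ((u r ^ 2 + v r ^ 2 - α) * v r ^ 2 - u r * v r / r - (u r ^ 2 + v r ^ 2 + β) * u r ^ 2) r := by
    intro r hr
    refine ((h.hasDeriv_u r hr).mul (h.hasDeriv_v r hr)).congr_deriv ?_
    ring
  -- Near the origin of phase space `u v` is a Lyapunov function: its derivative is at most `-(α /
  -- 2) (u² + v²) ≤ -α u v`.
  have hprod_le : ∀ r, R ≤ r →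
      (u r ^ 2 + v r ^ 2 - α) * v r ^ 2 - u r * v r / r - (u r ^ 2 + v r ^ 2 + β) * u r ^ 2 ≤
        -(α / 2) * (u r ^ 2 + v r ^ 2) := by
    intro r hr
    have hr0 : 0 < r := hR0.trans_le hr
    have h1 := (hR r hr).1
    have h2 := hu r hr0
    have h3 := hv r hr0.le
    have h4 : 0 ≤ u r * v r / r := by positivity
    have h5 : (u r ^ 2 + v r ^ 2 - α) * v r ^ 2 ≤ -(α / 2) * v r ^ 2 := by
      gcongr
      linarith
    have h6 : α / 2 * u r ^ 2 ≤ (u r ^ 2 + v r ^ 2 + β) * u r ^ 2 := by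
      gcongr
      linarith [sq_nonneg (u r), sq_nonneg (v r)]
    linarith
  have hexp : ∀ r, R ≤ r → u r * v r ≤ u R * v R * Real.exp (α * R) * Real.exp (-(α * r)) := by
    intro r hr
    have hcu := h.cont_u.mono (fun t (ht : t ∈ Set.Icc R r) => hR0.le.trans ht.1)
    have hcv := h.cont_v.mono (fun t (ht : t ∈ Set.Icc R r) => hR0.le.trans ht.1)
    have h1 := le_of_hasDerivAt_nonpos (f := fun t => u t * v t * Real.exp (α * t)) hr
      (by fun_prop)
      (fun t ht => (hprod t (hR0.trans ht.1)).mul (((hasDerivAt_id t).const_mul α).exp))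
      (fun t ht => by
        have h1 := hprod_le t ht.1.le
        have h2 : α * (u t * v t) ≤ α / 2 * (u t ^ 2 + v t ^ 2) := by
          nlinarith [sq_nonneg (u t - v t)]
        have h3 := Real.exp_pos (α * t)
        simp only [id]
        nlinarith)
    calc u r * v r = u r * v r * Real.exp (α * r) * Real.exp (-(α * r)) := by
          rw [mul_assoc, ← Real.exp_add]; simp
      _ ≤ _ := by gcongr
  have hfar : ∀ r, R + 1 ≤ r → u r ^ 2 + v r ^ 2 ≤
      2 / α * (u R * v R * Real.exp (α * R) * Real.exp α) * Real.exp (-(α * r)) := by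
    intro r hr
    -- Decay passes from `u v` to `u² + v²`: over `[r - 1, r]` the product drops by less than its
    -- value at `r - 1`, yet by at least `(α / 2) (u² + v²)` at `r`, since `u² + v²` decreases.
    obtain ⟨ξ, hξ, hslope⟩ := exists_hasDerivAt_eq_slope (fun r => u r * v r) _
      (show r - 1 < r by linarith)
      (fun t ht => (hprod t (by linarith [ht.1])).continuousAt.continuousWithinAt)
      (fun t ht => hprod t (by linarith [ht.1]))
    have h1 := hprod_le ξ (by linarith [hξ.1])
    have h2 := hanti ξ r (by linarith [hξ.1]) hξ.2.le
    have h3 := hexp (r - 1) (by linarith)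
    have h4 : 0 < u r * v r := mul_pos (hu r (by linarith)) (hv r (by linarith))
    rw [hslope, sub_sub_cancel, div_one] at h1
    have h5 : α / 2 * (u r ^ 2 + v r ^ 2) ≤ α / 2 * (u ξ ^ 2 + v ξ ^ 2) := by gcongr
    have h6 : Real.exp (-(α * (r - 1))) = Real.exp α * Real.exp (-(α * r)) := by
      rw [← Real.exp_add]; ring_nf
    rw [h6] at h3
    have h7 : α / 2 * (u r ^ 2 + v r ^ 2) ≤
        u R * v R * Real.exp (α * R) * Real.exp α * Real.exp (-(α * r)) := by linarith
    calc u r ^ 2 + v r ^ 2 = 2 / α * (α / 2 * (u r ^ 2 + v r ^ 2)) := by field_simp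
      _ ≤ 2 / α * (u R * v R * Real.exp (α * R) * Real.exp α * Real.exp (-(α * r))) := by gcongr
      _ = _ := by ring
  have huR := hu R hR0
  have hvR := hv R hR0.le
  have hv00 := hv 0 le_rfl
  refine ⟨2 / α * (u R * v R * Real.exp (α * R) * Real.exp α) +
    (u 0 ^ 2 + v 0 ^ 2) * Real.exp (α * (R + 1)), by positivity, fun r hr => ?_⟩
  rw [add_mul]
  rcases le_total (R + 1) r with hrR | hrR
  · have h1 : 0 ≤ (u 0 ^ 2 + v 0 ^ 2) * Real.exp (α * (R + 1)) * Real.exp (-(α * r)) := by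
      positivity
    linarith [hfar r hrR]
  · have h1 : 0 ≤ 2 / α * (u R * v R * Real.exp (α * R) * Real.exp α) * Real.exp (-(α * r)) := by
      positivity
    have h2 : 1 ≤ Real.exp (α * (R + 1)) * Real.exp (-(α * r)) := by
      rw [← Real.exp_add]
      refine Real.one_le_exp ?_
      nlinarith
    have h3 : u 0 ^ 2 + v 0 ^ 2 ≤
        (u 0 ^ 2 + v 0 ^ 2) * (Real.exp (α * (R + 1)) * Real.exp (-(α * r))) :=
      le_mul_of_one_le_right (by positivity) h2
    linarith [hanti 0 r le_rfl hr]

end RadialFlow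

/-! ### The spinor field on the plane -/

section Spinor

/-- The spinor field `(V(|x|²), i (x₁ + i x₂) U(|x|²))`. -/
noncomputable def radialSpinor (U V : ℝ → ℝ) (x : Plane) : Spinor :=
  !₂[(V (x 0 ^ 2 + x 1 ^ 2) : ℂ),
    Complex.I * ((x 0 : ℂ) + Complex.I * (x 1 : ℂ)) * (U (x 0 ^ 2 + x 1 ^ 2) : ℂ)]

theorem norm_sq_radialSpinor (U V : ℝ → ℝ) (x : Plane) :
    ‖radialSpinor U V x‖ ^ 2 = (x 0 ^ 2 + x 1 ^ 2) * U (x 0 ^ 2 + x 1 ^ 2) ^ 2 +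
      V (x 0 ^ 2 + x 1 ^ 2) ^ 2 := by
  rw [EuclideanSpace.norm_sq_eq, Fin.sum_univ_two]
  simp only [radialSpinor, Complex.sq_norm, Complex.normSq_apply]
  simp
  ring

theorem contDiff_comp_normSq {U : ℝ → ℝ} (hU : ContDiffOn ℝ (⊤ : ℕ∞) U (Set.Ici 0)) :
    ContDiff ℝ (⊤ : ℕ∞) fun x : Plane => U (x 0 ^ 2 + x 1 ^ 2) := by
  have h : ContDiff ℝ (⊤ : ℕ∞) fun x : Plane => x 0 ^ 2 + x 1 ^ 2 := by fun_prop
  exact contDiffOn_univ.1 (hU.comp h.contDiffOn fun x _ => by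
    simp only [Set.mem_Ici]; positivity)

theorem contDiff_radialSpinor {U V : ℝ → ℝ} (hU : ContDiffOn ℝ (⊤ : ℕ∞) U (Set.Ici 0))
    (hV : ContDiffOn ℝ (⊤ : ℕ∞) V (Set.Ici 0)) : ContDiff ℝ (⊤ : ℕ∞) (radialSpinor U V) := by
  have hof : ContDiff ℝ (⊤ : ℕ∞) (fun r : ℝ => (r : ℂ)) := Complex.ofRealCLM.contDiff
  have h1 := hof.comp (contDiff_comp_normSq hU)
  have h2 := hof.comp (contDiff_comp_normSq hV)
  have h3 : ContDiff ℝ (⊤ : ℕ∞) fun x : Plane => (x 0 : ℂ) :=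
    hof.comp (by fun_prop : ContDiff ℝ (⊤ : ℕ∞) fun x : Plane => x 0)
  have h4 : ContDiff ℝ (⊤ : ℕ∞) fun x : Plane => (x 1 : ℂ) :=
    hof.comp (by fun_prop : ContDiff ℝ (⊤ : ℕ∞) fun x : Plane => x 1)
  refine (contDiff_piLp 2).2 fun i => ?_
  fin_cases i
  · exact h2
  · exact (contDiff_const.mul (h3.add (contDiff_const.mul h4))).mul h1

theorem partialDeriv_apply_eq {ψ : Plane → Spinor} {x : Plane} (hψ : DifferentiableAt ℝ ψ x)
    {i j : Fin 2} {d : ℂ}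
    (hd : HasDerivAt (fun t : ℝ => ψ (x + t • EuclideanSpace.single j (1 : ℝ)) i) d 0) :
    partialDeriv j ψ x i = d := by
  have hcurve : HasDerivAt (fun t : ℝ => x + t • EuclideanSpace.single j (1 : ℝ))
      (EuclideanSpace.single j (1 : ℝ)) 0 := by
    simpa using ((hasDerivAt_id (0 : ℝ)).smul_const (EuclideanSpace.single j (1 : ℝ))).const_add x
  have h1 := HasFDerivAt.comp_hasDerivAt_of_eq (0 : ℝ) hψ.hasFDerivAt hcurve (by simp)
  have h2 := ((EuclideanSpace.proj i : Spinor →L[ℂ] ℂ).restrictScalars ℝ).hasFDerivAt.comp_hasDerivAt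
    (0 : ℝ) h1
  exact h2.unique hd

variable {U V : ℝ → ℝ} {x : Plane} {U' V' : ℝ}

theorem hasDerivAt_comp_normSq (hV : HasDerivWithinAt V V' (Set.Ici 0) (x 0 ^ 2 + x 1 ^ 2))
    (j : Fin 2) :
    HasDerivAt (fun t : ℝ => ((V ((x + t • EuclideanSpace.single j (1 : ℝ)) 0 ^ 2 +
      (x + t • EuclideanSpace.single j (1 : ℝ)) 1 ^ 2) : ℝ) : ℂ)) ((V' * (2 * x j) : ℝ) : ℂ) 0 := by
  have hq : HasDerivAt (fun t : ℝ => (x + t • EuclideanSpace.single j (1 : ℝ)) 0 ^ 2 +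
      (x + t • EuclideanSpace.single j (1 : ℝ)) 1 ^ 2) (2 * x j) 0 := by
    have hlin : ∀ k c : ℝ, HasDerivAt (fun t : ℝ => (k + t * c) ^ 2) (2 * k * c) 0 := fun k c => by
      refine ((((hasDerivAt_id (0 : ℝ)).mul_const c).const_add k).pow 2).congr_deriv ?_
      simp
    fin_cases j
    · refine ((hlin (x 0) 1).add (hlin (x 1) 0)).congr_deriv (by simp) |>.congr_of_eventuallyEq ?_
      exact Eventually.of_forall fun t => by simp
    · refine ((hlin (x 0) 0).add (hlin (x 1) 1)).congr_deriv (by simp) |>.congr_of_eventuallyEq ?_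
      exact Eventually.of_forall fun t => by simp
  exact (hV.comp_hasDerivAt_of_eq (0 : ℝ) hq (Eventually.of_forall fun t => by
    simp only [Set.mem_Ici]; positivity) (by simp)).ofReal_comp

theorem partialDeriv_radialSpinor (hψ : DifferentiableAt ℝ (radialSpinor U V) x)
    (hU : HasDerivWithinAt U U' (Set.Ici 0) (x 0 ^ 2 + x 1 ^ 2))
    (hV : HasDerivWithinAt V V' (Set.Ici 0) (x 0 ^ 2 + x 1 ^ 2)) :
    (partialDeriv 0 (radialSpinor U V) x 0 = V' * (2 * x 0) ∧
      partialDeriv 1 (radialSpinor U V) x 0 = V' * (2 * x 1)) ∧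
    (partialDeriv 0 (radialSpinor U V) x 1 = Complex.I * (U (x 0 ^ 2 + x 1 ^ 2) +
        (x 0 + Complex.I * x 1) * (U' * (2 * x 0))) ∧
      partialDeriv 1 (radialSpinor U V) x 1 = Complex.I * (Complex.I * U (x 0 ^ 2 + x 1 ^ 2) +
        (x 0 + Complex.I * x 1) * (U' * (2 * x 1)))) := by
  have hz : ∀ p q : ℂ, HasDerivAt (fun t : ℝ => Complex.I * (p + (t : ℂ) * q)) (Complex.I * q) 0 :=
    fun p q => by
      simpa using ((((hasDerivAt_id (0 : ℝ)).ofReal_comp).mul_const q).const_add p).const_mul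
        Complex.I
  refine ⟨⟨partialDeriv_apply_eq hψ ?_, partialDeriv_apply_eq hψ ?_⟩,
    partialDeriv_apply_eq hψ ?_, partialDeriv_apply_eq hψ ?_⟩
  · exact (hasDerivAt_comp_normSq hV 0).congr_deriv (by push_cast; ring)
  · exact (hasDerivAt_comp_normSq hV 1).congr_deriv (by push_cast; ring)
  · refine (((hz (x 0 + Complex.I * x 1) 1).mul (hasDerivAt_comp_normSq hU 0)).congr_deriv
      ?_).congr_of_eventuallyEq (Eventually.of_forall fun t => ?_)
    · simp; ring
    · simp [radialSpinor]
      left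
      ring
  · refine (((hz (x 0 + Complex.I * x 1) Complex.I).mul
      (hasDerivAt_comp_normSq hU 1)).congr_deriv
      ?_).congr_of_eventuallyEq (Eventually.of_forall fun t => ?_)
    · simp
      linear_combination (-(U (x 0 ^ 2 + x 1 ^ 2) : ℂ)) * Complex.I_sq
    · simp [radialSpinor]
      left
      ring

theorem isSmoothSolution_radialSpinor {m ω : ℝ} (h : SquaredFlow (m - ω) (m + ω) U V) :
    IsSmoothSolution m ω (radialSpinor U V) := by
  have hψ := contDiff_radialSpinor h.contDiffOn_U h.contDiffOn_V
  refine ⟨hψ, fun x => ?_⟩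
  have hs : 0 ≤ x 0 ^ 2 + x 1 ^ 2 := by positivity
  obtain ⟨U', hU', hEq⟩ := h.exists_hasDerivWithinAt_U hs
  obtain ⟨⟨h1, h2⟩, h3, h4⟩ := partialDeriv_radialSpinor (hψ.differentiable (by simp) x) hU'
    (h.hasDerivWithinAt_V hs)
  have hN := norm_sq_radialSpinor U V x
  have hc := congrArg (Complex.ofReal) hEq
  push_cast at hc
  rw [hN]
  ext i
  fin_cases i
  · simp [diracOp, act, pauli1, pauli2, pauli3, h3, h4, dotProduct,
      Fin.sum_univ_two, radialSpinor]
    -- The upper component is the regularised `U`-equation, valid also at the origin; the lower one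
    -- is the `V`-equation.
    linear_combination hc +
      (-((U (x 0 ^ 2 + x 1 ^ 2) : ℂ) + 2 * x 0 ^ 2 * U') + (Complex.I ^ 2 - 1) *
        ((U (x 0 ^ 2 + x 1 ^ 2) : ℂ) + 2 * x 1 ^ 2 * U')) * Complex.I_sq
  · simp [diracOp, act, pauli1, pauli2, pauli3, h1, h2, dotProduct,
      Fin.sum_univ_two, radialSpinor]
    ring_nf

end Spinor

/-! ### Membership in the shooting set and conclusion -/

theorem exists_smooth_radialFlow {α β : ℝ} (hα : 0 ≤ α) (hβ : 0 ≤ β) (a : ℝ) :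
    ∃ u v U V : ℝ → ℝ, RadialFlow α β a u v ∧ SquaredFlow α β U V ∧
      ∀ r, 0 ≤ r → u r = r * U (r ^ 2) ∧ v r = V (r ^ 2) := by
  obtain ⟨u, v, J, h, -, hJ, hu⟩ := exists_radialFlow hα hβ a
  refine ⟨u, v, _, _, h, h.squaredFlow hJ hu, fun r hr => ?_⟩
  simp [Real.sqrt_sq hr, hu r hr]

theorem isRadialSolution_of_squaredFlow {m ω a : ℝ} {u v U V : ℝ → ℝ}
    (h : RadialFlow (m - ω) (m + ω) a u v) (hs : SquaredFlow (m - ω) (m + ω) U V)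
    (huv : ∀ r, 0 ≤ r → u r = r * U (r ^ 2) ∧ v r = V (r ^ 2)) : IsRadialSolution m ω a u v where
  contDiffOn_u := by
    have h1 : ContDiffOn ℝ 1 (fun r => U (r ^ 2)) (Set.Ici 0) :=
      (hs.contDiffOn_nat 1).1.comp (by fun_prop) fun r _ => sq_nonneg r
    exact (contDiffOn_id.mul h1).congr fun r hr => (huv r hr).1
  contDiffOn_v := by
    have h1 : ContDiffOn ℝ 1 (fun r => V (r ^ 2)) (Set.Ici 0) :=
      (hs.contDiffOn_nat 1).2.comp (by fun_prop) fun r _ => sq_nonneg r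
    exact h1.congr fun r hr => (huv r hr).2
  u_zero := h.u_zero
  v_zero := h.v_zero
  eq_u r hr := by rw [(h.hasDeriv_u r hr).deriv]; ring
  eq_v r hr := by rw [(h.hasDeriv_v r hr).deriv]; ring

/-- With its converse `mem_shootingSet_of_pos_and_neg`, this replaces the limit and the weak sign
condition by strict conditions, and uniqueness transfers them to any chosen flow. -/
theorem pos_and_neg_of_mem_shootingSet {m ω a : ℝ} {u v : ℝ → ℝ} (hω : 0 < ω) (hωm : ω < m)
    (ha : a ∈ shootingSet m ω) (h : RadialFlow (m - ω) (m + ω) a u v) :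
    0 < a ∧ (∀ r, 0 ≤ r → 0 < v r) ∧
      ∃ R, 0 ≤ R ∧ hamiltonian (m - ω) (m + ω) (u R) (v R) < 0 := by
  have hα : 0 ≤ m - ω := by linarith
  have hβ : 0 < m + ω := by linarith
  obtain ⟨ha0, u', v', hsol, hsign, L, hL, hlim⟩ := ha
  have h' := hsol.radialFlow
  have heq : ∀ r, 0 ≤ r → u r = u' r ∧ v r = v' r := fun r hr => h.unique hα hβ.le h' hr
  have hnonneg : ∀ r, 0 < r → 0 ≤ v' r := by
    intro r hr
    have hev : ∀ᶠ t in 𝓝[≥] (0 : ℝ), 0 < v' t :=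
      (h'.cont_v 0 Set.self_mem_Ici).eventually (lt_mem_nhds (by rwa [h'.v_zero]))
    obtain ⟨s, hs, hs0⟩ := ((hev.filter_mono (nhdsWithin_mono _ Set.Ioi_subset_Ici_self)).and
      self_mem_nhdsWithin).exists
    exact nonneg_of_mul_nonneg_left (hsign r s hr hs0) hs
  refine ⟨ha0, fun r hr => (heq r hr).2 ▸ h'.v_pos_of_nonneg hα hβ ha0 hnonneg hr, ?_⟩
  obtain ⟨R, hR, hR0⟩ := ((hlim.eventually (gt_mem_nhds hL)).and (eventually_ge_atTop 0)).exists
  refine ⟨R, hR0, ?_⟩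
  rw [(heq R hR0).1, (heq R hR0).2, ← energy_eq_hamiltonian]
  exact hR

theorem mem_shootingSet_of_pos_and_neg {m ω a R : ℝ} {u v : ℝ → ℝ} (hω : 0 < ω) (hωm : ω < m)
    (ha : 0 < a) (h : RadialFlow (m - ω) (m + ω) a u v) (hv : ∀ r, 0 ≤ r → 0 < v r) (hR : 0 ≤ R)
    (hH : hamiltonian (m - ω) (m + ω) (u R) (v R) < 0) : a ∈ shootingSet m ω := by
  have hα : 0 ≤ m - ω := by linarith
  have hβ : 0 ≤ m + ω := by linarith
  obtain ⟨u', v', U, V, h', hs, huv⟩ := exists_smooth_radialFlow hα hβ a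
  have heq : ∀ r, 0 ≤ r → u' r = u r ∧ v' r = v r := fun r hr => h'.unique hα hβ h hr
  obtain ⟨L, hlim, -, hL⟩ := exists_tendsto_of_antitone
    (f := fun r => hamiltonian (m - ω) (m + ω) (u' r) (v' r))
    (fun r s hr hrs => h'.hamiltonian_antitone hβ hr hrs) (fun r _ => hamiltonian_ge hβ _ _)
  refine ⟨ha, u', v', isRadialSolution_of_squaredFlow h' hs huv, fun r s hr hs => ?_, L, ?_, ?_⟩
  · rw [(heq r hr.le).2, (heq s hs.le).2]
    exact (mul_pos (hv r hr.le) (hv s hs.le)).le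
  · refine (hL R hR).trans_lt ?_
    rw [(heq R hR).1, (heq R hR).2]
    exact hH
  · simpa only [energy_eq_hamiltonian] using hlim

theorem radialFlow_equilibrium {α β : ℝ} (hα : 0 ≤ α) :
    RadialFlow α β √α (fun _ => 0) (fun _ => √α) := by
  refine ⟨continuousOn_const, continuousOn_const, rfl, rfl, fun r _ => ?_, fun r _ => ?_⟩
  · exact (hasDerivAt_const r 0).congr_deriv (by simp [Real.sq_sqrt hα])
  · exact (hasDerivAt_const r _).congr_deriv (by simp)

end CubicDirac

theorem theorem1 (m ω : ℝ) (hω : 0 < ω) (hωm : ω < m) :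
    (CubicDirac.shootingSet m ω).Nonempty ∧
    BddAbove (CubicDirac.shootingSet m ω) ∧
    ∃ (a : ℝ) (u v : ℝ → ℝ) (ψ : CubicDirac.Plane → CubicDirac.Spinor),
      0 < a ∧
      IsLUB (CubicDirac.shootingSet m ω) a ∧
      CubicDirac.IsRadialSolution m ω a u v ∧
      (∀ r : ℝ, 0 ≤ r → 0 < v r) ∧
      Tendsto u atTop (𝓝 0) ∧
      Tendsto v atTop (𝓝 0) ∧
      CubicDirac.HasRadialForm ψ u v ∧
      ψ ≠ 0 ∧
      CubicDirac.IsSmoothSolution m ω ψ ∧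
      ∃ C : ℝ, 0 < C ∧
        ∀ x : CubicDirac.Plane, ‖ψ x‖ ≤ C * Real.exp (-((m - ω) / 2) * ‖x‖) := by
  open CubicDirac in
  have hα : 0 < m - ω := by linarith
  have hαβ : m - ω < m + ω := by linarith
  have hβ : 0 < m + ω := by linarith
  choose uf vf Uf Vf hf hsf huvf using
    fun a => exists_smooth_radialFlow hα.le hβ.le a
  have hmem : √(m - ω) ∈ shootingSet m ω := by
    refine mem_shootingSet_of_pos_and_neg hω hωm (Real.sqrt_pos.2 hα)
      (radialFlow_equilibrium hα.le) (fun _ _ => Real.sqrt_pos.2 hα) le_rfl ?_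
    simp only [hamiltonian, Real.sq_sqrt hα.le]
    nlinarith
  have hbdd : BddAbove (shootingSet m ω) := by
    refine ⟨√((m + ω) / Real.exp (-7000)), fun a ha => ?_⟩
    obtain ⟨ha0, hv, -⟩ := pos_and_neg_of_mem_shootingSet hω hωm ha (hf a)
    exact Real.le_sqrt_of_sq_le ((hf a).sq_le_of_v_pos hα hαβ ha0 hv)
  have hlub := isLUB_csSup ⟨_, hmem⟩ hbdd
  set a := sSup (shootingSet m ω)
  have ha0 : 0 < a := (Real.sqrt_pos.2 hα).trans_le (hlub.1 hmem)
  have hv : ∀ r, 0 ≤ r → 0 < vf a r := by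
    intro r hr
    refine (hf a).v_pos_of_nonneg hα.le hβ ha0 (fun t ht => ?_) hr
    -- Members of the set accumulate at `a`, and a negative value of `v` would be inherited by
    -- nearby ones.
    by_contra! hneg
    obtain ⟨b, hb, hclose⟩ := ((hlub.frequently_mem ⟨_, hmem⟩).filter_mono
      nhdsWithin_le_nhds).and_eventually
      (RadialFlow.eventually_close hα.le hβ.le hf a t (neg_pos.2 hneg)) |>.exists
    have h1 := (abs_lt.1 (hclose t ⟨ht.le, le_rfl⟩).2).2
    have h2 := (pos_and_neg_of_mem_shootingSet hω hωm hb (hf b)).2.1 t ht.le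
    linarith
  have hH : ∀ r, 0 ≤ r → 0 ≤ hamiltonian (m - ω) (m + ω) (uf a r) (vf a r) := by
    intro R hR
    by_contra! hneg
    -- Negative energy at `a` would, by openness, put some `b > a` in the set.
    have hev := RadialFlow.eventually_pos_and_neg hα.le hβ.le hf hR hv hneg
    obtain ⟨b, ⟨hvb, hHb⟩, hab⟩ := ((hev.filter_mono nhdsWithin_le_nhds).and
      (self_mem_nhdsWithin (s := Set.Ioi a))).exists
    have hab : a < b := hab
    exact absurd (hlub.1 (mem_shootingSet_of_pos_and_neg hω hωm (ha0.trans hab) (hf b) hvb hR hHb))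
      (not_le.2 hab)
  obtain ⟨hu0, hv0⟩ := (hf a).tendsto_zero hα hβ.le hv hH
  obtain ⟨C, hC, hdecay⟩ := (hf a).exists_normSq_le_exp hα hαβ.le hv hH
  have hform : HasRadialForm (radialSpinor (Uf a) (Vf a)) (uf a) (vf a) := by
    intro r θ hr
    have h1 : (r * Real.cos θ) ^ 2 + (r * Real.sin θ) ^ 2 = r ^ 2 := by
      rw [mul_pow, mul_pow, ← mul_add, Real.cos_sq_add_sin_sq, mul_one]
    have h2 : Complex.exp (Complex.I * (θ : ℂ)) =
        (Real.cos θ : ℂ) + Complex.I * (Real.sin θ : ℂ) := by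
      rw [mul_comm, Complex.exp_mul_I, Complex.ofReal_cos, Complex.ofReal_sin]
      ring
    rw [h2, (huvf a r hr).1, (huvf a r hr).2]
    ext i
    fin_cases i
    · simp [radialSpinor, polarPoint, h1]
    · simp [radialSpinor, polarPoint, h1]
      ring
  refine ⟨⟨_, hmem⟩, hbdd, a, uf a, vf a, radialSpinor (Uf a) (Vf a), ha0, hlub,
    isRadialSolution_of_squaredFlow (hf a) (hsf a) (huvf a), hv, hu0, hv0, hform, ?_,
    isSmoothSolution_radialSpinor (hsf a), √C, Real.sqrt_pos.2 hC, fun x => ?_⟩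
  · intro h0
    have h1 := congrArg (fun z : Spinor => z 0) (hform 0 0 le_rfl)
    rw [h0] at h1
    have h2 := hv 0 le_rfl
    have h3 : (0 : ℂ) = (vf a 0 : ℂ) := by simpa using h1
    exact h2.ne (by exact_mod_cast h3)
  · have hx : ‖x‖ ^ 2 = x 0 ^ 2 + x 1 ^ 2 := by
      rw [EuclideanSpace.real_norm_sq_eq, Fin.sum_univ_two]
    have h1 := hdecay ‖x‖ (norm_nonneg x)
    rw [(huvf a _ (norm_nonneg x)).1, (huvf a _ (norm_nonneg x)).2, mul_pow, hx] at h1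
    refine abs_le_of_sq_le_sq' ?_ (by positivity) |>.2
    rw [norm_sq_radialSpinor, mul_pow, Real.sq_sqrt hC.le, ← Real.exp_nat_mul]
    refine h1.trans (le_of_eq ?_)
    push_cast
    ring_nf
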